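/- Let $(X,\mathscr F,\mu)$ be a probability space with a filtration $(\mathscr F_t)_{t\ge 0}$ of sub-$\sigma$-algebras of $\mathscr F$ that is right continuous, $\mathscr F_t=\bigcap_{s>t}\mathscr F_s$ for all $t\ge 0$, and such that $\mathscr F_0$ is the $\sigma$-algebra generated by the $\mu$-null sets. Let $E$ be a real Banach space whose dual $E'$ has the Radon–Nikodým property. Let $H^1(\mu,E)$ be the space of càdlàg $E$-valued martingales $M$ with $M^*_\infty=\sup_{t\ge 0}\|M_t\|_E\in L^1(\mu)$ for which there is $M_\infty\in L^1(\mu,E)$ with $M_t=\mathbb E[M_\infty\mid\mathscr F_t]$ $\mu$-a.e. for each $t\ge 0$; martingales that agree outside an evanescent set are identified, and the norm is $\|M\|_{H^1}=\|M^*_\infty\|_{L^1(\mu)}$. A set $\mathcal K\subset L^1(\mu)$ is called uniformly integrable if it is $L^1$-bounded and for every $\varepsilon>0$ there is $\delta>0$ such that $\int_A|\xi|\,d\mu\le\varepsilon$ for all $\xi\in\mathcal K$ and all $A\in\mathscr F$ with $\mu(A)\le\delta$. The u.c.p. topology is given by the metric $D(M,N)=\sum_{n\ge1}2^{-n}\int_X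 1\wedge\sup_{s\le n}\|M_s-N_s\|_E\,d\mu$. Let $K\subset H^1(\mu,E)$ and $K^*=\{M^*_\infty: M\in K\}$. Then the following are equivalent. 1. $K$ is relatively weakly compact in $H^1(\mu,E)$. 2. $K^*$ is uniformly integrable, and for every sequence $(M^n)_n$ in $K$ there exist $N^i\in\operatorname{co}\{M^n:n\ge i\}$ and $N\in H^1(\mu,E)$ such that $(N^i)_i$ converges to $N$ in the u.c.p. topology. 3. $K^*$ is uniformly integrable, and for every sequence $(M^n)_n$ in $K$ there exist $N^i\in\operatorname{co}\{M^n:n\ge i\}$ and $N\in H^1(\mu,E)$ such that, for each $t\in[0,\infty)$, for $\mu$-a.e. $\omega$, $(N^i_t(\omega))_i$ converges to $N_t(\omega)$ in the weak topology $\sigma(E,E')$. -/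

import Mathlib

open MeasureTheory Filter Topology Set
open scoped NNReal ENNReal

universe u v

/-- The Radon–Nikodým property of a real normed space `F`: for every finite measure space
`(Ω, 𝒜, ν)`, every countably additive vector measure `G : 𝒜 → F` of bounded variation which
vanishes on the `ν`-null sets has a Bochner integrable density with respect to `ν`. -/
def HasRadonNikodymProperty (F : Type v) [NormedAddCommGroup F] [NormedSpace ℝ F] : Prop :=
  ∀ (Ω : Type u) (_ : MeasurableSpace Ω) (ν : Measure Ω), IsFiniteMeasure ν →
    ∀ G : VectorMeasure Ω F, G.variation univ < ∞ →
      (∀ A : Set Ω, MeasurableSet A → ν A = 0 → G A = 0) →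
      ∃ g : Ω → F, Integrable g ν ∧ ∀ A : Set Ω, MeasurableSet A → G A = ∫ ω in A, g ω ∂ν

section Processes

variable {X : Type u} {E : Type v} [NormedAddCommGroup E]

/-- All paths of the process `M` are càdlàg: right continuous with left limits. -/
def IsCadlag (M : ℝ≥0 → X → E) : Prop :=
  ∀ ω : X, ∀ t : ℝ≥0, ContinuousWithinAt (fun s => M s ω) (Ici t) t ∧
    ∃ l : E, Tendsto (fun s => M s ω) (𝓝[<] t) (𝓝 l)

/-- The running maximal function `M*_t = sup_{s ≤ t} ‖M_s‖`, with values in `[0, ∞]`. -/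
noncomputable def maximalUpTo (M : ℝ≥0 → X → E) (t : ℝ≥0) (ω : X) : ℝ≥0∞ :=
  ⨆ s : ℝ≥0, ⨆ _ : s ≤ t, ‖M s ω‖ₑ

/-- The maximal function `M*_∞ = sup_t ‖M_t‖`, with values in `[0, ∞]`. -/
noncomputable def maximalFunction (M : ℝ≥0 → X → E) (ω : X) : ℝ≥0∞ :=
  ⨆ t : ℝ≥0, ‖M t ω‖ₑ

theorem IsCadlag.add {M N : ℝ≥0 → X → E} (hM : IsCadlag M) (hN : IsCadlag N) :
    IsCadlag (M + N) := fun ω t => by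
  obtain ⟨h1, l1, k1⟩ := hM ω t
  obtain ⟨h2, l2, k2⟩ := hN ω t
  exact ⟨h1.add h2, l1 + l2, k1.add k2⟩

theorem IsCadlag.smul [NormedSpace ℝ E] {M : ℝ≥0 → X → E} (hM : IsCadlag M) (c : ℝ) :
    IsCadlag (c • M) := fun ω t => by
  obtain ⟨h1, l1, k1⟩ := hM ω t
  exact ⟨h1.const_smul c, c • l1, k1.const_smul c⟩

theorem maximalFunction_add_le (M N : ℝ≥0 → X → E) (ω : X) :
    maximalFunction (M + N) ω ≤ maximalFunction M ω + maximalFunction N ω :=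
  iSup_le fun t => (enorm_add_le _ _).trans
    (add_le_add (le_iSup (fun t => ‖M t ω‖ₑ) t) (le_iSup (fun t => ‖N t ω‖ₑ) t))

theorem maximalFunction_smul [NormedSpace ℝ E] (c : ℝ) (M : ℝ≥0 → X → E) (ω : X) :
    maximalFunction (c • M) ω = ‖c‖ₑ * maximalFunction M ω := by
  simp only [maximalFunction, Pi.smul_apply, enorm_smul, ENNReal.mul_iSup]

theorem maximalFunction_eq_zero {M : ℝ≥0 → X → E} {ω : X} :
    maximalFunction M ω = 0 ↔ ∀ t, M t ω = 0 := by
  simp [maximalFunction]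

/-- The maximal function of a càdlàg process is a supremum over countably many times. -/
theorem maximalFunction_eq_iSup_dense {M : ℝ≥0 → X → E} (hM : IsCadlag M) (ω : X) :
    maximalFunction M ω = ⨆ n : ℕ, ‖M (TopologicalSpace.denseSeq ℝ≥0 n) ω‖ₑ := by
  refine le_antisymm (iSup_le fun t => ?_) (iSup_le fun n => le_iSup (fun t => ‖M t ω‖ₑ) _)
  have h : Tendsto (fun s => ‖M s ω‖ₑ) (𝓝[>] t) (𝓝 ‖M t ω‖ₑ) :=
    (((hM ω t).1.tendsto).mono_left (nhdsWithin_mono _ Ioi_subset_Ici_self)).enorm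
  by_contra! hlt
  have hev := h.eventually_const_lt hlt
  rw [eventually_nhdsWithin_iff, eventually_nhds_iff] at hev
  obtain ⟨U, hU, hUo, htU⟩ := hev
  have hne : (U ∩ Ioi t).Nonempty := by
    have : U ∈ 𝓝[>] t := mem_nhdsWithin_of_mem_nhds (hUo.mem_nhds htU)
    exact nonempty_of_mem (inter_mem this self_mem_nhdsWithin)
  obtain ⟨n, hn⟩ := (TopologicalSpace.denseRange_denseSeq ℝ≥0).exists_mem_open
    (hUo.inter isOpen_Ioi) hne
  exact absurd (le_iSup (fun n : ℕ => ‖M (TopologicalSpace.denseSeq ℝ≥0 n) ω‖ₑ) n)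
    (not_le.2 (hU _ hn.1 hn.2))

/-- The distance `D(M, N) = ∑_{n ≥ 1} 2⁻ⁿ ∫ min (1, (M - N)*_n) dμ` defining the topology of
uniform convergence on compacts in probability. -/
noncomputable def ucpDist {mX : MeasurableSpace X} (μ : Measure X) (M N : ℝ≥0 → X → E) : ℝ≥0∞ :=
  ∑' n : ℕ, (2 : ℝ≥0∞)⁻¹ ^ (n + 1) *
    ∫⁻ ω, min 1 (maximalUpTo (M - N) ((n + 1 : ℕ) : ℝ≥0) ω) ∂μ

end Processes

section Hardy

variable {X : Type u} {mX : MeasurableSpace X} (𝓕 : Filtration ℝ≥0 mX) (μ : Measure X)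
  (E : Type v) [NormedAddCommGroup E] [NormedSpace ℝ E]

variable {E} in
/-- `M` is a càdlàg `E`-valued martingale whose maximal function is integrable and which has a
terminal value in `L¹(μ, E)`. -/
structure IsHardyMartingale (M : ℝ≥0 → X → E) : Prop where
  martingale : Martingale M 𝓕 μ
  cadlag : IsCadlag M
  lintegral_lt_top : ∫⁻ ω, maximalFunction M ω ∂μ < ∞
  terminal : ∃ ξ : X → E, Integrable ξ μ ∧ ∀ t : ℝ≥0, M t =ᵐ[μ] μ[ξ | 𝓕 t]

variable {𝓕 μ E}

theorem IsHardyMartingale.measurable_maximalFunction {M : ℝ≥0 → X → E}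
    (hM : IsHardyMartingale 𝓕 μ M) : Measurable (maximalFunction M) := by
  have : maximalFunction M =
      fun ω => ⨆ n : ℕ, ‖M (TopologicalSpace.denseSeq ℝ≥0 n) ω‖ₑ :=
    funext fun ω => maximalFunction_eq_iSup_dense hM.cadlag ω
  rw [this]
  exact Measurable.iSup fun n =>
    ((hM.martingale.1 _).mono (𝓕.le _)).enorm

theorem IsHardyMartingale.lintegral_add_le {M N : ℝ≥0 → X → E}
    (hM : IsHardyMartingale 𝓕 μ M) :
    ∫⁻ ω, maximalFunction (M + N) ω ∂μ ≤
      ∫⁻ ω, maximalFunction M ω ∂μ + ∫⁻ ω, maximalFunction N ω ∂μ := by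
  rw [← lintegral_add_left hM.measurable_maximalFunction]
  exact lintegral_mono fun ω => maximalFunction_add_le M N ω

theorem lintegral_maximalFunction_smul (c : ℝ) (M : ℝ≥0 → X → E) :
    ∫⁻ ω, maximalFunction (c • M) ω ∂μ = ‖c‖ₑ * ∫⁻ ω, maximalFunction M ω ∂μ := by
  simp only [maximalFunction_smul]
  exact lintegral_const_mul' _ _ (by simp)

theorem IsHardyMartingale.zero : IsHardyMartingale 𝓕 μ (0 : ℝ≥0 → X → E) where
  martingale := martingale_zero E 𝓕 μ
  cadlag := fun _ _ => ⟨continuousWithinAt_const, 0, tendsto_const_nhds⟩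
  lintegral_lt_top := by simp [maximalFunction]
  terminal := ⟨0, integrable_zero _ _ _, fun t => by simp [condExp_zero]⟩

variable [CompleteSpace E]

theorem IsHardyMartingale.add {M N : ℝ≥0 → X → E} (hM : IsHardyMartingale 𝓕 μ M)
    (hN : IsHardyMartingale 𝓕 μ N) : IsHardyMartingale 𝓕 μ (M + N) where
  martingale := hM.martingale.add hN.martingale
  cadlag := hM.cadlag.add hN.cadlag
  lintegral_lt_top := hM.lintegral_add_le.trans_lt
    (ENNReal.add_lt_top.2 ⟨hM.lintegral_lt_top, hN.lintegral_lt_top⟩)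
  terminal := by
    obtain ⟨ξ, hξ, h1⟩ := hM.terminal
    obtain ⟨η, hη, h2⟩ := hN.terminal
    exact ⟨ξ + η, hξ.add hη, fun t => ((h1 t).add (h2 t)).trans (condExp_add hξ hη _).symm⟩

theorem IsHardyMartingale.smul {M : ℝ≥0 → X → E} (hM : IsHardyMartingale 𝓕 μ M) (c : ℝ) :
    IsHardyMartingale 𝓕 μ (c • M) where
  martingale := hM.martingale.smul c
  cadlag := hM.cadlag.smul c
  lintegral_lt_top := by
    rw [lintegral_maximalFunction_smul]
    exact ENNReal.mul_lt_top (by simp) hM.lintegral_lt_top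
  terminal := by
    obtain ⟨ξ, hξ, h1⟩ := hM.terminal
    exact ⟨c • ξ, hξ.smul c, fun t => ((h1 t).const_smul c).trans (condExp_smul c ξ _).symm⟩

variable (𝓕 μ E)

/-- The vector space of the processes satisfying `IsHardyMartingale`. -/
def hardySubmodule : Submodule ℝ (ℝ≥0 → X → E) where
  carrier := {M | IsHardyMartingale 𝓕 μ M}
  add_mem' := IsHardyMartingale.add
  zero_mem' := IsHardyMartingale.zero
  smul_mem' c _ hM := hM.smul c

/-- The processes satisfying `IsHardyMartingale`, as a type that will carry the seminorm
`‖M*_∞‖_{L¹}` (and not the topology of pointwise convergence). -/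
def HardyMartingale : Type (max u v) := hardySubmodule 𝓕 μ E

namespace HardyMartingale

noncomputable instance : AddCommGroup (HardyMartingale 𝓕 μ E) :=
  inferInstanceAs (AddCommGroup (hardySubmodule 𝓕 μ E))

noncomputable instance : Module ℝ (HardyMartingale 𝓕 μ E) :=
  inferInstanceAs (Module ℝ (hardySubmodule 𝓕 μ E))

/-- The underlying process, as a linear map. -/
def toProcess : HardyMartingale 𝓕 μ E →ₗ[ℝ] (ℝ≥0 → X → E) := (hardySubmodule 𝓕 μ E).subtype

variable {𝓕 μ E}

theorem isHardyMartingale (M : HardyMartingale 𝓕 μ E) :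
    IsHardyMartingale 𝓕 μ (toProcess 𝓕 μ E M) := Subtype.property (p := (· ∈ hardySubmodule 𝓕 μ E)) M

/-- Every process satisfying `IsHardyMartingale` is an element of `HardyMartingale`. -/
def ofProcess (M : ℝ≥0 → X → E) (hM : IsHardyMartingale 𝓕 μ M) : HardyMartingale 𝓕 μ E :=
  Subtype.mk (p := (· ∈ hardySubmodule 𝓕 μ E)) M hM

@[simp] theorem toProcess_ofProcess (M : ℝ≥0 → X → E) (hM : IsHardyMartingale 𝓕 μ M) :
    toProcess 𝓕 μ E (ofProcess M hM) = M := rfl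

noncomputable instance : Norm (HardyMartingale 𝓕 μ E) :=
  ⟨fun M => (∫⁻ ω, maximalFunction (toProcess 𝓕 μ E M) ω ∂μ).toReal⟩

theorem norm_def (M : HardyMartingale 𝓕 μ E) :
    ‖M‖ = (∫⁻ ω, maximalFunction (toProcess 𝓕 μ E M) ω ∂μ).toReal := rfl

variable (𝓕 μ E) in
theorem core : SeminormedSpace.Core ℝ (HardyMartingale 𝓕 μ E) where
  norm_nonneg _ := ENNReal.toReal_nonneg
  norm_smul c M := by
    simp [norm_def, lintegral_maximalFunction_smul]
  norm_triangle M N := by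
    have hM := M.isHardyMartingale
    have hN := N.isHardyMartingale
    rw [norm_def, norm_def, norm_def, map_add,
      ← ENNReal.toReal_add hM.lintegral_lt_top.ne hN.lintegral_lt_top.ne]
    exact ENNReal.toReal_mono
      (ENNReal.add_lt_top.2 ⟨hM.lintegral_lt_top, hN.lintegral_lt_top⟩).ne hM.lintegral_add_le

noncomputable instance : SeminormedAddCommGroup (HardyMartingale 𝓕 μ E) :=
  SeminormedAddCommGroup.ofCore (core 𝓕 μ E)

noncomputable instance : NormedSpace ℝ (HardyMartingale 𝓕 μ E) where
  norm_smul_le c M := ((core 𝓕 μ E).norm_smul c M).le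

end HardyMartingale

/-- The martingale Hardy space `H¹(μ, E)`: the processes satisfying `IsHardyMartingale`, identified
when they are at seminorm distance zero, that is, when they agree outside an evanescent set
(see `HardySpace.mk_eq_mk`), with the norm `‖M*_∞‖_{L¹}` (see `HardySpace.norm_eq`). -/
abbrev HardySpace : Type (max u v) := SeparationQuotient (HardyMartingale 𝓕 μ E)

namespace HardySpace

variable {𝓕 μ E}

/-- A representative process of an element of `H¹(μ, E)`; it is unique up to evanescence
(see `HardySpace.process_mk`). -/
noncomputable def process (M : HardySpace 𝓕 μ E) : ℝ≥0 → X → E :=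
  HardyMartingale.toProcess 𝓕 μ E (Quotient.out M)

theorem isHardyMartingale_process (M : HardySpace 𝓕 μ E) : IsHardyMartingale 𝓕 μ M.process :=
  HardyMartingale.isHardyMartingale _

theorem mk_eq_mk (M N : HardyMartingale 𝓕 μ E) :
    (SeparationQuotient.mk M : HardySpace 𝓕 μ E) = SeparationQuotient.mk N ↔
      ∀ᵐ ω ∂μ, ∀ t, HardyMartingale.toProcess 𝓕 μ E M t ω =
        HardyMartingale.toProcess 𝓕 μ E N t ω := by
  have h := (M - N).isHardyMartingale
  rw [SeparationQuotient.mk_eq_mk, Metric.inseparable_iff, dist_eq_norm,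
    HardyMartingale.norm_def, ENNReal.toReal_eq_zero_iff, or_iff_left h.lintegral_lt_top.ne,
    lintegral_eq_zero_iff h.measurable_maximalFunction]
  refine eventually_congr (Eventually.of_forall fun ω => ?_)
  rw [Pi.zero_apply, maximalFunction_eq_zero]
  simp [sub_eq_zero]

theorem process_mk (M : HardyMartingale 𝓕 μ E) :
    ∀ᵐ ω ∂μ, ∀ t, process (SeparationQuotient.mk M) t ω =
      HardyMartingale.toProcess 𝓕 μ E M t ω :=
  (mk_eq_mk _ _).1 (Quotient.out_eq _)

theorem norm_eq (M : HardySpace 𝓕 μ E) :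
    ‖M‖ = (∫⁻ ω, maximalFunction M.process ω ∂μ).toReal := by
  conv_lhs => rw [← Quotient.out_eq M]
  exact SeparationQuotient.norm_mk (Quotient.out M)

end HardySpace

end Hardy

/-- A subset of a real normed space is relatively weakly compact when its closure in the weak
topology is weakly compact. -/
def IsRelWeaklyCompact {V : Type v} [NormedAddCommGroup V] [NormedSpace ℝ V] (K : Set V) : Prop :=
  IsCompact (closure (toWeakSpace ℝ V '' K))

section WeakCompactness

variable {V : Type v} [NormedAddCommGroup V] [NormedSpace ℝ V] {K : Set V}

theorem exists_strictMono_of_eventually {r : ℕ → ℕ → Prop} (h : ∀ m, ∀ᶠ n in atTop, r m n) (n₀ : ℕ) :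
    ∃ φ : ℕ → ℕ, StrictMono φ ∧ n₀ ≤ φ 0 ∧ ∀ k, r (φ k) (φ (k + 1)) := by
  choose g hg using fun m => ((h m).and (eventually_gt_atTop m)).exists
  exact ⟨fun k => Nat.rec n₀ (fun _ a => g a) k, strictMono_nat_of_lt_succ fun k => (hg _).2,
    le_rfl, fun k => (hg _).1⟩

/-- A sequence in a relatively weakly compact set has a weak cluster point. -/
theorem IsRelWeaklyCompact.exists_mapClusterPt (hK : IsRelWeaklyCompact K) {x : ℕ → V}
    (hx : ∀ n, x n ∈ K) :
    ∃ w : V, MapClusterPt (toWeakSpace ℝ V w) atTop fun n => toWeakSpace ℝ V (x n) := by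
  obtain ⟨z, -, hz⟩ := IsCompact.exists_mapClusterPt hK (f := atTop)
    (u := fun n => toWeakSpace ℝ V (x n))
    (le_principal_iff.2 <| Filter.mem_map.2 <| Eventually.of_forall fun n =>
      subset_closure (mem_image_of_mem _ (hx n)))
  exact ⟨(toWeakSpace ℝ V).symm z, by simpa using hz⟩

theorem MapClusterPt.dual_apply {x : ℕ → V} {w : V}
    (h : MapClusterPt (toWeakSpace ℝ V w) atTop fun n => toWeakSpace ℝ V (x n))
    (f : StrongDual ℝ V) : MapClusterPt (f w) atTop fun n => f (x n) :=
  MapClusterPt.continuousAt_comp (f := fun z : WeakSpace ℝ V => f ((toWeakSpace ℝ V).symm z))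
    (WeakBilin.eval_continuous (topDualPairing ℝ V).flip f).continuousAt h

theorem MapClusterPt.eq_of_tendsto {α β : Type*} [TopologicalSpace β] [T2Space β] {l : Filter α}
    {u : α → β} {a b : β} (ha : MapClusterPt a l u) (hb : Tendsto u l (𝓝 b)) : a = b := by
  have : NeBot (𝓝 a ⊓ 𝓝 b) := ha.clusterPt.neBot.mono (inf_le_inf_left _ hb)
  exact eq_of_nhds_neBot this

/-- Every sequence in a relatively weakly compact set has norm convergent convex blocks. -/
theorem IsRelWeaklyCompact.exists_convexHull_tendsto (hK : IsRelWeaklyCompact K) {x : ℕ → V}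
    (hx : ∀ n, x n ∈ K) :
    ∃ y : ℕ → V, (∀ i, y i ∈ convexHull ℝ {v | ∃ n ≥ i, v = x n}) ∧
      ∃ w : V, Tendsto y atTop (𝓝 w) := by
  obtain ⟨w, hw⟩ := hK.exists_mapClusterPt hx
  have key : ∀ i : ℕ, w ∈ closure (convexHull ℝ {v | ∃ n ≥ i, v = x n}) := by
    intro i
    have h1 : toWeakSpace ℝ V w ∈
        closure (toWeakSpace ℝ V '' convexHull ℝ {v | ∃ n ≥ i, v = x n}) := by
      refine isClosed_closure.mem_of_mapClusterPt hw ?_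
      filter_upwards [eventually_ge_atTop i] with n hn
      exact subset_closure (mem_image_of_mem _ (subset_convexHull ℝ _ ⟨n, hn, rfl⟩))
    rw [← (convex_convexHull ℝ _).toWeakSpace_closure ℝ] at h1
    obtain ⟨w', h2, h3⟩ := h1
    rwa [← (toWeakSpace ℝ V).injective h3]
  choose y hy1 hy2 using fun i : ℕ =>
    Metric.mem_closure_iff.1 (key i) (1 / ((i : ℝ) + 1)) (by positivity)
  refine ⟨y, hy1, w, tendsto_iff_dist_tendsto_zero.2 ?_⟩
  exact squeeze_zero (fun _ => dist_nonneg) (fun i => (dist_comm _ _).trans_le (hy2 i).le)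
    tendsto_one_div_add_atTop_nhds_zero_nat

theorem IsRelWeaklyCompact.exists_norm_le (hK : IsRelWeaklyCompact K) :
    ∃ C, ∀ x ∈ K, ‖x‖ ≤ C := by
  obtain ⟨C, hC⟩ := banach_steinhaus
    (g := fun x : K => NormedSpace.inclusionInDoubleDual ℝ V x) (fun f => by
      have hcont : Continuous fun z : WeakSpace ℝ V => f ((toWeakSpace ℝ V).symm z) :=
        WeakBilin.eval_continuous (topDualPairing ℝ V).flip f
      obtain ⟨C, hC⟩ := IsCompact.exists_bound_of_continuousOn hK hcont.continuousOn
      exact ⟨C, fun x => by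
        simpa using hC _ (subset_closure (mem_image_of_mem _ x.2))⟩)
  refine ⟨C, fun x hx => ?_⟩
  have := hC ⟨x, hx⟩
  rwa [← (NormedSpace.inclusionInDoubleDualLi (E := V) ℝ).norm_map x]

theorem exists_finset_norming {W : Type v} [NormedAddCommGroup W] [NormedSpace ℝ W]
    {T : Set (StrongDual ℝ W)} (hT : T.Finite) :
    ∃ F : Finset W, (∀ f ∈ F, ‖f‖ ≤ 1) ∧
      ∀ φ ∈ Submodule.span ℝ T, ∃ f ∈ F, ‖φ‖ ≤ 2 * |φ f| := by
  classical
  have : FiniteDimensional ℝ (Submodule.span ℝ T) := FiniteDimensional.span_of_finite ℝ hT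
  generalize Submodule.span ℝ T = G at *
  have : ProperSpace G := FiniteDimensional.proper ℝ G
  have hex : ∀ φ : G, ∃ f : W, ‖f‖ ≤ 1 ∧ (‖φ‖ = 1 → 1 / 2 < |(φ : StrongDual ℝ W) f|) := by
    intro φ
    by_cases hφ : ‖φ‖ = 1
    · obtain ⟨f, hf, hf'⟩ := ContinuousLinearMap.exists_lt_apply_of_lt_opNorm
        (φ : StrongDual ℝ W) (r := 1 / 2) (by
          have : ‖(φ : StrongDual ℝ W)‖ = 1 := hφ
          rw [this]; norm_num)
      exact ⟨f, hf.le, fun _ => hf'⟩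
    · exact ⟨0, by simp, fun h => absurd h hφ⟩
  choose f hf1 hf2 using hex
  obtain ⟨s, hs⟩ := (isCompact_sphere (0 : G) 1).elim_finite_subcover
    (fun φ : G => {ψ : G | 1 / 2 < |(ψ : StrongDual ℝ W) (f φ)|})
    (fun φ => isOpen_lt continuous_const (by fun_prop))
    (fun φ hφ => mem_iUnion.2 ⟨φ, hf2 φ (by
      have h : dist (φ : StrongDual ℝ W) 0 = 1 := hφ
      rwa [dist_zero_right] at h)⟩)
  refine ⟨insert 0 (s.image f), ?_, fun φ hφ => ?_⟩
  · simp only [Finset.mem_insert, Finset.mem_image]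
    rintro _ (rfl | ⟨φ, -, rfl⟩)
    · simp
    · exact hf1 φ
  by_cases h0 : φ = 0
  · exact ⟨0, by simp, by simp [h0]⟩
  have hn : 0 < ‖φ‖ := norm_pos_iff.2 h0
  have hmem : (‖φ‖⁻¹ • (⟨φ, hφ⟩ : G)) ∈ Metric.sphere (0 : G) 1 := by
    have h : dist (‖φ‖⁻¹ • φ) 0 = 1 := by
      rw [dist_zero_right, norm_smul]
      simp [hn.ne']
    exact h
  obtain ⟨ψ, hψ, h⟩ := mem_iUnion₂.1 (hs hmem)
  refine ⟨f ψ, Finset.mem_insert_of_mem (Finset.mem_image_of_mem f hψ), ?_⟩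
  simp only [mem_ofPred_eq, SetLike.val_smul, _root_.smul_apply, smul_eq_mul, abs_mul,
    abs_inv, abs_norm] at h
  rw [inv_mul_eq_div, lt_div_iff₀ hn] at h
  linarith

theorem tendsto_of_norm_sub_le {W : Type*} [NormedAddCommGroup W] {u : ℕ → W} {x : W} {b : ℕ → ℝ}
    (h : ∀ i, ‖x - u i‖ ≤ b i) (hb : Tendsto b atTop (𝓝 0)) : Tendsto u atTop (𝓝 x) :=
  tendsto_iff_norm_sub_tendsto_zero.2 (squeeze_zero (fun _ => norm_nonneg _)
    (fun i => (norm_sub_rev _ _).trans_le (h i)) hb)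

/-- A bounded set is relatively weakly compact as soon as each of its sequences has norm
convergent convex blocks. -/
theorem isRelWeaklyCompact_of_convexHull_tendsto {C : ℝ} (hC : ∀ x ∈ K, ‖x‖ ≤ C)
    (h : ∀ x : ℕ → V, (∀ n, x n ∈ K) →
      ∃ y : ℕ → V, (∀ i, y i ∈ convexHull ℝ {v | ∃ n ≥ i, v = x n}) ∧
        ∃ w : V, Tendsto y atTop (𝓝 w)) :
    IsRelWeaklyCompact K := by
  classical
  refine NormedSpace.isCompact_closure_of_isBounded ℝ V _ ?_ ?_
  · refine (isBounded_iff_forall_norm_le.2 ⟨C, fun x hx => ?_⟩)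
    obtain ⟨x', hx', he⟩ := hx
    rw [← (toWeakSpace ℝ V).injective he]
    exact hC _ hx'
  intro z hz
  let φ : StrongDual ℝ (StrongDual ℝ V) := WeakDual.toStrongDual z
  let J := NormedSpace.inclusionInDoubleDual ℝ V
  have happrox : ∀ (F : Finset (StrongDual ℝ V)) (ε : ℝ), 0 < ε →
      ∃ x ∈ K, ∀ f ∈ F, |f x - φ f| ≤ ε := by
    intro F ε hε
    have hopen : IsOpen (⋂ f ∈ F, {z' : WeakDual ℝ (StrongDual ℝ V) | |z' f - z f| < ε}) :=
      isOpen_biInter_finset fun f _ => isOpen_lt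
        (((WeakDual.eval_continuous f).sub continuous_const).abs) continuous_const
    obtain ⟨_, h1, _, ⟨x, hx, rfl⟩, rfl⟩ := mem_closure_iff.1 hz _ hopen (by simp [hε])
    refine ⟨x, hx, fun f hf => ?_⟩
    have := mem_iInter₂.1 h1 f hf
    exact le_of_lt this
  choose F hF1 hF2 using fun S : Finset V =>
    exists_finset_norming (W := StrongDual ℝ V) (T := insert φ (J '' S))
      ((S.finite_toSet.image J).insert φ)
  obtain ⟨a, ha1, ha2⟩ := exists_seq_of_forall_finset_exists
    (fun a : Finset V × V × ℕ => a.2.1 ∈ K)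
    (fun a b => insert a.2.1 a.1 ⊆ b.1 ∧ a.2.2 < b.2.2 ∧
      ∀ f ∈ F a.1, |f b.2.1 - φ f| ≤ 1 / ((b.2.2 : ℝ) + 1)) (fun s _ => by
      obtain ⟨x, hx, hx'⟩ := happrox (s.biUnion fun a => F a.1)
        (1 / (((s.sup fun a => a.2.2) + 1 : ℕ) + 1)) (by positivity)
      refine ⟨(s.biUnion fun a => insert a.2.1 a.1, x, (s.sup fun a => a.2.2) + 1), hx,
        fun b hb => ⟨Finset.subset_biUnion_of_mem (fun a : Finset V × V × ℕ => insert a.2.1 a.1) hb,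
          Nat.lt_succ_of_le (Finset.le_sup (f := fun a : Finset V × V × ℕ => a.2.2) hb),
          fun f hf => hx' f (Finset.mem_biUnion.2 ⟨b, hb, hf⟩)⟩⟩)
  have hn : StrictMono fun n => (a n).2.2 := fun m n hmn => (ha2 m n hmn).2.1
  obtain ⟨y, hy1, w, hy2⟩ := h (fun n => (a n).2.1) ha1
  have hlim : ∀ n, ∀ f ∈ F (a n).1, f w = φ f := by
    intro n f hf
    have h1 : ∀ i > n, |f (y i) - φ f| ≤ 1 / ((i : ℝ) + 1) := by
      intro i hi
      have hconv : Convex ℝ {v : V | |f v - φ f| ≤ 1 / ((i : ℝ) + 1)} := by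
        have : {v : V | |f v - φ f| ≤ 1 / ((i : ℝ) + 1)} =
            f ⁻¹' Metric.closedBall (φ f) (1 / ((i : ℝ) + 1)) := by
          ext v; simp [Real.dist_eq]
        rw [this]
        exact (convex_closedBall _ _).linear_preimage f.toLinearMap
      refine convexHull_min ?_ hconv (hy1 i)
      rintro _ ⟨m, hm, rfl⟩
      refine ((ha2 n m (by omega)).2.2 f hf).trans ?_
      have : (i : ℝ) ≤ (a m).2.2 := by exact_mod_cast le_trans hm (hn.id_le m)
      gcongr
    have h2 : Tendsto (fun i => |f (y i) - φ f|) atTop (𝓝 |f w - φ f|) :=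
      (((f.continuous.tendsto w).comp hy2).sub_const _).abs
    have h3 : Tendsto (fun i => |f (y i) - φ f|) atTop (𝓝 0) :=
      squeeze_zero' (Eventually.of_forall fun _ => abs_nonneg _)
        ((eventually_gt_atTop n).mono h1) tendsto_one_div_add_atTop_nhds_zero_nat
    exact sub_eq_zero.1 (abs_eq_zero.1 (tendsto_nhds_unique h2 h3))
  have hspan : ∀ i, ∃ n, y i ∈ Submodule.span ℝ ((a n).1 : Set V) := by
    intro i
    have hdir : Directed (· ≤ ·) fun n => Submodule.span ℝ ((a n).1 : Set V) := by
      refine (monotone_nat_of_le_succ fun n => Submodule.span_mono ?_).directed_le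
      exact_mod_cast (Finset.subset_insert _ _).trans (ha2 n (n + 1) n.lt_succ_self).1
    rw [← Submodule.mem_iSup_of_directed _ hdir]
    refine convexHull_min ?_ (Submodule.convex _) (hy1 i)
    rintro _ ⟨m, -, rfl⟩
    refine Submodule.mem_iSup_of_mem (m + 1) (Submodule.subset_span ?_)
    exact (ha2 m (m + 1) m.lt_succ_self).1 (Finset.mem_insert_self _ _)
  have hbound : ∀ i, ‖φ - J (y i)‖ ≤ 2 * ‖w - y i‖ := by
    intro i
    obtain ⟨n, hn⟩ := hspan i
    have hmem : φ - J (y i) ∈ Submodule.span ℝ (insert φ (J '' (a n).1)) := by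
      refine sub_mem (Submodule.subset_span (mem_insert _ _)) ?_
      refine Submodule.span_mono (subset_insert _ _) ?_
      have := Submodule.mem_map_of_mem (f := J.toLinearMap) hn
      rwa [Submodule.map_span] at this
    obtain ⟨f, hf, hle⟩ := hF2 _ _ hmem
    have hf' : ‖f‖ ≤ 1 ∧ f w = φ f := by
      exact ⟨hF1 _ f hf, hlim n f hf⟩
    have heq : (φ - J (y i)) f = f (w - y i) := by
      rw [_root_.sub_apply, map_sub, hf'.2]; rfl
    rw [heq] at hle
    refine hle.trans (mul_le_mul_of_nonneg_left ?_ two_pos.le)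
    exact (f.le_opNorm _).trans (mul_le_of_le_one_left (norm_nonneg _) hf'.1)
  have h0 : Tendsto (fun i => ‖w - y i‖) atTop (𝓝 0) := by
    simpa [norm_sub_rev] using tendsto_iff_norm_sub_tendsto_zero.1 hy2
  have h1 : Tendsto (fun i => J (y i)) atTop (𝓝 φ) :=
    tendsto_of_norm_sub_le (W := StrongDual ℝ (StrongDual ℝ V)) (x := φ) hbound
      (by simpa using h0.const_mul 2)
  have h2 : φ = J w := tendsto_nhds_unique h1 ((J.continuous.tendsto w).comp hy2)
  refine ⟨toWeakSpace ℝ V w, ?_⟩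
  have : WeakDual.toStrongDual z = J w := h2
  apply WeakDual.toStrongDual.injective
  rw [this]
  rfl

theorem abs_tsum_le_tsum_abs {f : ℕ → ℝ} (hf : Summable fun m => |f m|) :
    |∑' m, f m| ≤ ∑' m, |f m| :=
  norm_tsum_le_tsum_norm (f := f) (by simpa only [Real.norm_eq_abs] using hf)

theorem exists_dual_apply_eq_tsum {ℓ : ℕ → StrongDual ℝ V} {C : ℝ}
    (hsum : ∀ v, Summable fun m => |ℓ m v|) (hC : ∀ v, ∑' m, |ℓ m v| ≤ C * ‖v‖) :
    ∃ L : StrongDual ℝ V, ∀ v, L v = ∑' m, ℓ m v := by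
  let L₀ : V →ₗ[ℝ] ℝ :=
    { toFun := fun v => ∑' m, ℓ m v
      map_add' := fun v v' => by
        simp only [map_add]
        exact (hsum v).of_abs.tsum_add (hsum v').of_abs
      map_smul' := fun c v => by
        simp only [map_smul, smul_eq_mul, RingHom.id_apply]
        exact tsum_mul_left }
  exact ⟨L₀.mkContinuous C fun v => (abs_tsum_le_tsum_abs (f := fun m => ℓ m v) (hsum v)).trans (hC v),
    fun _ => rfl⟩

/-- On a relatively weakly compact set, the terms of a series of functionals that converges
absolutely at every point tend to zero uniformly. -/
theorem IsRelWeaklyCompact.not_forall_le_apply (hK : IsRelWeaklyCompact K)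
    {ℓ : ℕ → StrongDual ℝ V} {C : ℝ} (hsum : ∀ v, Summable fun m => |ℓ m v|)
    (hC : ∀ v, ∑' m, |ℓ m v| ≤ C * ‖v‖) {x : ℕ → V} (hx : ∀ n, x n ∈ K) {ε : ℝ} (hε : 0 < ε) :
    ¬ ∀ n, ε ≤ ℓ n (x n) := by
  intro hle
  obtain ⟨R, hR⟩ := hK.exists_norm_le
  have hC0 : ∀ m v, |ℓ m v| ≤ C * ‖v‖ := fun m v =>
    ((hsum v).le_tsum m fun _ _ => abs_nonneg _).trans (hC v)
  have hbd : ∀ n, (fun m => ℓ m (x n)) ∈ Set.pi univ fun _ : ℕ => Metric.closedBall (0 : ℝ) (|C| * R) :=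
    fun n m _ => by
      rw [mem_closedBall_zero_iff, Real.norm_eq_abs]
      exact (hC0 m _).trans (mul_le_mul (le_abs_self C) (hR _ (hx n)) (norm_nonneg _) (abs_nonneg _))
  obtain ⟨a, -, ψ, hψ, hlim⟩ :=
    (isCompact_univ_pi fun _ => isCompact_closedBall (0 : ℝ) (|C| * R)).tendsto_subseq hbd
  rw [tendsto_pi_nhds] at hlim
  have hcluster : ∀ φ : ℕ → ℕ, StrictMono φ → ∃ w : V,
      MapClusterPt (toWeakSpace ℝ V w) atTop (fun n => toWeakSpace ℝ V (x (ψ (φ n)))) ∧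
        ∀ m, ℓ m w = a m := by
    intro φ hφ
    obtain ⟨w, hw⟩ := hK.exists_mapClusterPt fun n => hx (ψ (φ n))
    exact ⟨w, hw, fun m => (hw.dual_apply (ℓ m)).eq_of_tendsto ((hlim m).comp hφ.tendsto_atTop)⟩
  obtain ⟨w, -, hwa⟩ := hcluster id strictMono_id
  have hhead : ∀ m : ℕ, ∀ᶠ n in atTop,
      ∑ j ∈ Finset.range (ψ m + 1), |ℓ j (x (ψ n) - w)| ≤ ε / 8 := by
    intro m
    have : Tendsto (fun n => ∑ j ∈ Finset.range (ψ m + 1), |ℓ j (x (ψ n) - w)|) atTop (𝓝 0) := by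
      rw [← Finset.sum_const_zero (s := Finset.range (ψ m + 1))]
      refine tendsto_finsetSum _ fun j _ => ?_
      simpa [hwa] using ((hlim j).sub_const (ℓ j w)).abs
    exact this.eventually_le_const (by positivity)
  have htail : ∀ m : ℕ, ∀ᶠ n in atTop, ∑' j, |ℓ (j + ψ n) (x (ψ m) - w)| ≤ ε / 8 := fun m =>
    ((tendsto_sum_nat_add fun j => |ℓ j (x (ψ m) - w)|).comp
      hψ.tendsto_atTop).eventually_le_const (by positivity)
  have hdiag : ∀ᶠ n in atTop, |ℓ (ψ n) w| ≤ ε / 2 :=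
    ((hsum w).tendsto_atTop_zero.comp hψ.tendsto_atTop).eventually_le_const (by positivity)
  obtain ⟨n₀, hn₀⟩ := eventually_atTop.1 hdiag
  obtain ⟨φ, hφ, hφ0, hφr⟩ :=
    exists_strictMono_of_eventually (fun m => (hhead m).and (htail m)) n₀
  have hκ : StrictMono fun k => ψ (φ k) := hψ.comp hφ
  have hsumκ : ∀ v, Summable fun k => |ℓ (ψ (φ k)) v| := fun v =>
    (hsum v).comp_injective hκ.injective
  obtain ⟨L, hL⟩ := exists_dual_apply_eq_tsum hsumκ fun v => le_trans
    (tsum_comp_le_tsum_of_inj (hsum v) (fun _ => abs_nonneg _) hκ.injective) (hC v)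
  obtain ⟨w', hw', hwa'⟩ := hcluster φ hφ
  have hge : ∀ k, L w + ε / 4 ≤ L (x (ψ (φ (k + 1)))) := by
    intro k
    set U := x (ψ (φ (k + 1))) - w with hU
    have h1 : ε / 2 ≤ ℓ (ψ (φ (k + 1))) U := by
      have h2 := (abs_le.1 (hn₀ (φ (k + 1)) (hφ0.trans (hφ.monotone (Nat.zero_le _))))).2
      have h3 := hle (ψ (φ (k + 1)))
      rw [hU, map_sub]
      linarith
    have h2 : |∑ j ∈ Finset.range (k + 1), ℓ (ψ (φ j)) U| ≤ ε / 8 := by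
      refine (Finset.abs_sum_le_sum_abs _ _).trans (le_trans ?_ (hφr k).1)
      rw [← Finset.sum_image (f := fun j => |ℓ j U|) (g := fun j => ψ (φ j)) hκ.injective.injOn]
      refine Finset.sum_le_sum_of_subset_of_nonneg (fun i hi => ?_) fun _ _ _ => abs_nonneg _
      obtain ⟨j, hj, rfl⟩ := Finset.mem_image.1 hi
      exact Finset.mem_range.2 (Nat.lt_succ_of_le (hκ.monotone (Nat.lt_succ_iff.1 (Finset.mem_range.1 hj))))
    have h3 : |∑' j, ℓ (ψ (φ (j + (k + 2)))) U| ≤ ε / 8 := by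
      have hinj : Function.Injective fun j => ψ (φ (j + (k + 2))) - ψ (φ (k + 2)) := by
        intro i j hij
        have hi := hκ.monotone (Nat.le_add_left (k + 2) i)
        have hj := hκ.monotone (Nat.le_add_left (k + 2) j)
        have : ψ (φ (i + (k + 2))) = ψ (φ (j + (k + 2))) := by
          simp only at hij hi hj; omega
        exact Nat.add_right_cancel (hκ.injective this)
      have hs := (summable_nat_add_iff (f := fun j => |ℓ j U|) (ψ (φ (k + 2)))).2 (hsum U)
      have h4 := tsum_comp_le_tsum_of_inj hs (fun _ => abs_nonneg _) hinj
      refine (abs_tsum_le_tsum_abs (f := fun j => ℓ (ψ (φ (j + (k + 2)))) U)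
        ((summable_nat_add_iff (f := fun j => |ℓ (ψ (φ j)) U|) (k + 2)).2 (hsumκ U))).trans
        (le_trans (le_of_eq ?_) (h4.trans (hφr (k + 1)).2))
      refine tsum_congr fun j => ?_
      simp only [Function.comp_apply]
      rw [Nat.sub_add_cancel (hκ.monotone (Nat.le_add_left (k + 2) j))]
    have h4 : L U = ∑ j ∈ Finset.range (k + 1), ℓ (ψ (φ j)) U + ℓ (ψ (φ (k + 1))) U +
        ∑' j, ℓ (ψ (φ (j + (k + 2)))) U := by
      rw [hL, ← (hsumκ U).of_abs.sum_add_tsum_nat_add (k + 2), Finset.sum_range_succ]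
    have h5 : L (x (ψ (φ (k + 1)))) = L w + L U := by rw [hU, map_sub]; ring
    have := (abs_le.1 h2).1
    have := (abs_le.1 h3).1
    linarith
  have h1 : L w + ε / 4 ≤ L w' := by
    refine isClosed_Ici.mem_of_mapClusterPt (hw'.dual_apply L) ?_
    filter_upwards [eventually_ge_atTop 1] with k hk
    obtain ⟨k, rfl⟩ := Nat.exists_eq_succ_of_ne_zero (Nat.one_le_iff_ne_zero.1 hk)
    exact hge k
  have h2 : L w' = L w := by rw [hL, hL]; exact tsum_congr fun k => by rw [hwa, hwa']
  linarith

end WeakCompactness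

section VectorIntegration

variable {X : Type u} {mX : MeasurableSpace X} {μ : Measure X}

/-- A function whose integral over every measurable set is bounded by `C` times the measure of the
set is bounded by `C`. -/
theorem ae_norm_le_of_forall_norm_setIntegral_le [IsFiniteMeasure μ] {F : Type*}
    [NormedAddCommGroup F] [NormedSpace ℝ F] [CompleteSpace F] {g : X → F} (hg : Integrable g μ)
    {C : ℝ} (h : ∀ A, MeasurableSet A → ‖∫ ω in A, g ω ∂μ‖ ≤ C * μ.real A) :
    ∀ᵐ ω ∂μ, ‖g ω‖ ≤ C := by
  wlog hgm : StronglyMeasurable g generalizing g with H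
  · have he := hg.1.ae_eq_mk
    have := H (hg.congr he) (fun A hA => by
      rw [← setIntegral_congr_ae hA (he.mono fun ω hω _ => hω)]; exact h A hA)
      hg.1.stronglyMeasurable_mk
    filter_upwards [this, he] with ω h1 h2
    rwa [h2]
  obtain ⟨c, hc, hcl⟩ := hgm.isSeparable_range
  have hnull : ∀ x ∈ c, ∀ n : ℕ, C + 1 / ((n : ℝ) + 1) < ‖x‖ →
      μ {ω | ‖g ω - x‖ < 1 / ((n : ℝ) + 1)} = 0 := by
    intro x _ n hx
    set A := {ω | ‖g ω - x‖ < 1 / ((n : ℝ) + 1)} with hA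
    have hAm : MeasurableSet A :=
      (hgm.sub stronglyMeasurable_const).norm.measurable measurableSet_Iio
    have h1 : ‖∫ ω in A, (g ω - x) ∂μ‖ ≤ 1 / ((n : ℝ) + 1) * μ.real A :=
      norm_setIntegral_le_of_norm_le_const (measure_lt_top _ _) fun ω hω => le_of_lt hω
    rw [integral_sub hg.integrableOn (integrable_const x), setIntegral_const] at h1
    have h2 : ‖μ.real A • x‖ ≤ ‖∫ ω in A, g ω ∂μ‖ + ‖∫ ω in A, g ω ∂μ - μ.real A • x‖ := by
      rw [norm_sub_rev]
      exact norm_le_norm_add_norm_sub' _ _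
    rw [norm_smul, Real.norm_of_nonneg measureReal_nonneg] at h2
    have h3 := h A hAm
    have h4 : μ.real A = 0 := by
      by_contra hne
      have hpos : 0 < μ.real A := lt_of_le_of_ne measureReal_nonneg (Ne.symm hne)
      nlinarith
    exact (measureReal_eq_zero_iff).1 h4
  have hall : ∀ᵐ ω ∂μ, ∀ x ∈ c, ∀ n : ℕ, C + 1 / ((n : ℝ) + 1) < ‖x‖ →
      ¬ ‖g ω - x‖ < 1 / ((n : ℝ) + 1) := by
    rw [ae_ball_iff hc]
    intro x hx
    rw [ae_all_iff]
    intro n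
    by_cases hn : C + 1 / ((n : ℝ) + 1) < ‖x‖
    · have := hnull x hx n hn
      rw [measure_eq_zero_iff_ae_notMem] at this
      filter_upwards [this] with ω hω _ using hω
    · exact Eventually.of_forall fun _ hn' => absurd hn' hn
  filter_upwards [hall] with ω hω
  by_contra! hlt
  obtain ⟨n, hn⟩ := exists_nat_one_div_lt (half_pos (sub_pos.2 hlt))
  obtain ⟨x, hx, hd⟩ := Metric.mem_closure_iff.1 (hcl (mem_range_self ω)) _
    (Nat.one_div_pos_of_nat (α := ℝ) (n := n))
  rw [dist_eq_norm] at hd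
  refine hω x hx n ?_ hd
  have := norm_sub_norm_le (g ω) x
  linarith

/-- If `E'` has the Radon–Nikodým property, then the functionals on `L¹(μ, E)` are given by bounded
measurable functions with values in `E'`. -/
theorem HasRadonNikodymProperty.exists_density {E : Type v} [NormedAddCommGroup E] [NormedSpace ℝ E]
    (hE : HasRadonNikodymProperty.{u} (StrongDual ℝ E)) [IsFiniteMeasure μ]
    (ℓ : StrongDual ℝ (Lp E 1 μ)) :
    ∃ g : X → StrongDual ℝ E, Integrable g μ ∧ (∀ᵐ ω ∂μ, ‖g ω‖ ≤ ‖ℓ‖) ∧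
      ∀ f : Lp E 1 μ, ℓ f = ∫ ω, g ω (f ω) ∂μ := by
  classical
  let T : ∀ A : Set X, MeasurableSet A → StrongDual ℝ E := fun A hA =>
    LinearMap.mkContinuous
      { toFun := fun x => ℓ (indicatorConstLp 1 hA (measure_ne_top μ A) x)
        map_add' := fun x y => by rw [← indicatorConstLp_add, map_add]
        map_smul' := fun a x => by
          rw [RingHom.id_apply, ← map_smul]
          congr 1
          ext1
          refine indicatorConstLp_coeFn.trans ((Lp.coeFn_smul _ _).trans ?_).symm
          filter_upwards [indicatorConstLp_coeFn (p := 1) (hs := hA) (hμs := measure_ne_top μ A)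
            (c := x)] with ω hω
          rw [Pi.smul_apply, hω]
          by_cases h : ω ∈ A <;> simp [h] } (‖ℓ‖ * μ.real A) (fun x => by
      refine (ℓ.le_opNorm _).trans_eq ?_
      rw [norm_indicatorConstLp one_ne_zero ENNReal.one_ne_top]
      simp
      ring)
  have hT : ∀ A hA x, T A hA x = ℓ (indicatorConstLp 1 hA (measure_ne_top μ A) x) :=
    fun _ _ _ => rfl
  have hTn : ∀ A hA, ‖T A hA‖ ≤ ‖ℓ‖ * μ.real A := fun A hA =>
    LinearMap.mkContinuous_norm_le _ (by positivity) _
  let ν : Measure X := ‖ℓ‖₊ • μ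
  let m : Set X → StrongDual ℝ E := fun A => if hA : MeasurableSet A then T A hA else 0
  have hm : ∀ A (hA : MeasurableSet A), m A = T A hA := fun A hA => dif_pos hA
  have hle : ∀ A, ‖m A‖ₑ ≤ ν A := by
    intro A
    by_cases hA : MeasurableSet A
    · rw [hm A hA, ← ofReal_norm]
      refine (ENNReal.ofReal_le_ofReal (hTn A hA)).trans_eq ?_
      rw [ENNReal.ofReal_mul (norm_nonneg _), ofReal_measureReal, Measure.smul_apply, ofReal_norm]
      rfl
    · rw [show m A = 0 from dif_neg hA]
      exact (enorm_zero (E := StrongDual ℝ E)).trans_le bot_le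
  let G : VectorMeasure X (StrongDual ℝ E) := VectorMeasure.of_additive_of_le_measure (μ := ν) m hle
    (fun s t hs ht hd => by
      rw [hm _ (hs.union ht), hm s hs, hm t ht]
      ext x
      rw [_root_.add_apply, hT, hT, hT, ← map_add,
        indicatorConstLp_disjoint_union hs ht (measure_ne_top _ _) (measure_ne_top _ _) hd])
    (fun s hs => dif_neg hs)
  have hG : ∀ A, G A = m A := fun _ => rfl
  obtain ⟨g, hg, hgG⟩ := hE X mX μ inferInstance G
    ((VectorMeasure.variation_le_of_forall_enorm_le (m := ν) (fun A _ => hle A) univ).trans_lt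
      (measure_lt_top ν univ))
    (fun A _ h0 => by
      have := hle A
      rw [Measure.smul_apply, h0, smul_zero, nonpos_iff_eq_zero] at this
      exact (enorm_eq_zero (E := StrongDual ℝ E)).1 this)
  have hgb : ∀ᵐ ω ∂μ, ‖g ω‖ ≤ ‖ℓ‖ := ae_norm_le_of_forall_norm_setIntegral_le hg fun A hA => by
    rw [← hgG A hA, hG, hm A hA]
    exact hTn A hA
  have hint : ∀ f : Lp E 1 μ, Integrable (fun ω => g ω (f ω)) μ := fun f => by
    have hf : Integrable (fun ω => f ω) μ := L1.integrable_coeFn f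
    refine (hf.norm.const_mul ‖ℓ‖).mono
      (isBoundedBilinearMap_apply.continuous.comp_aestronglyMeasurable (hg.1.prodMk hf.1)) ?_
    filter_upwards [hgb] with ω hω
    rw [norm_mul, norm_norm, norm_norm]
    exact (ContinuousLinearMap.le_opNorm _ _).trans
      (mul_le_mul_of_nonneg_right hω (norm_nonneg _))
  let L : Lp E 1 μ →ₗ[ℝ] ℝ :=
    { toFun := fun f => ∫ ω, g ω (f ω) ∂μ
      map_add' := fun f f' => by
        rw [← integral_add (hint f) (hint f')]
        refine integral_congr_ae ?_
        filter_upwards [Lp.coeFn_add f f'] with ω hω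
        rw [hω, Pi.add_apply, map_add]
      map_smul' := fun a f => by
        rw [RingHom.id_apply, smul_eq_mul, ← integral_const_mul]
        refine integral_congr_ae ?_
        filter_upwards [Lp.coeFn_smul a f] with ω hω
        rw [hω, Pi.smul_apply, map_smul, smul_eq_mul] }
  have hLc : Continuous L := by
    refine AddMonoidHomClass.continuous_of_bound L ‖ℓ‖ fun f => ?_
    have hf : Integrable (fun ω => f ω) μ := L1.integrable_coeFn f
    rw [L1.norm_eq_integral_norm, ← integral_const_mul]
    refine norm_integral_le_of_norm_le (hf.norm.const_mul _) ?_
    filter_upwards [hgb] with ω hω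
    exact (ContinuousLinearMap.le_opNorm _ _).trans
      (mul_le_mul_of_nonneg_right hω (norm_nonneg _))
  refine ⟨g, hg, hgb, fun f => ?_⟩
  change ℓ f = L f
  induction f using Lp.induction ENNReal.one_ne_top with
  | indicatorConst c hs hμs =>
    rename_i A
    rw [Lp.simpleFunc.coe_indicatorConst, ← hT A hs c, ← hm A hs, ← hG, hgG A hs,
      ContinuousLinearMap.integral_apply hg.integrableOn, ← integral_indicator hs]
    refine integral_congr_ae ?_
    filter_upwards [indicatorConstLp_coeFn (p := 1) (hs := hs) (hμs := measure_ne_top μ A)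
      (c := c)] with ω hω
    rw [hω]
    by_cases h : ω ∈ A <;> simp [h]
  | add hf hg' _ h1 h2 => rw [map_add, map_add, h1, h2]
  | isClosed => exact isClosed_eq ℓ.continuous hLc

/-- **Lévy's upward theorem** in `L¹`, for functions with values in a Banach space. -/
theorem tendsto_eLpNorm_condExp_sub {F : Type*} [NormedAddCommGroup F] [NormedSpace ℝ F]
    [CompleteSpace F] [IsFiniteMeasure μ] (𝒢 : Filtration ℕ mX) {f : X → F}
    (hf : Integrable f μ) (hfm : AEStronglyMeasurable[⨆ n, 𝒢 n] f μ) :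
    Tendsto (fun n => eLpNorm (μ[f | 𝒢 n] - f) 1 μ) atTop (𝓝 0) := by
  have hm : (⨆ n, 𝒢 n) ≤ mX := iSup_le fun n => 𝒢.le n
  refine MemLp.induction_stronglyMeasurable hm ENNReal.one_ne_top
    (fun f => Tendsto (fun n => eLpNorm (μ[f | 𝒢 n] - f) 1 μ) atTop (𝓝 0)) ?_ ?_ ?_ ?_
    (memLp_one_iff_integrable.2 hf) hfm
  · intro c s hs _
    have hs' : MeasurableSet s := hm s hs
    have h1 : Integrable (s.indicator fun _ => (1 : ℝ)) μ := (integrable_const 1).indicator hs'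
    have h2 : StronglyMeasurable[⨆ n, 𝒢 n] (s.indicator fun _ => (1 : ℝ)) :=
      stronglyMeasurable_const.indicator hs
    have h3 := h1.tendsto_eLpNorm_condExp h2
    have h6 := ENNReal.Tendsto.const_mul (a := ENNReal.ofReal ‖c‖) h3 (Or.inr ENNReal.ofReal_ne_top)
    rw [mul_zero] at h6
    refine tendsto_of_tendsto_of_tendsto_of_le_of_le tendsto_const_nhds h6 (fun _ => zero_le)
      fun n => ?_
    refine eLpNorm_le_mul_eLpNorm_of_ae_le_mul ?_ 1
    have h4 := (ContinuousLinearMap.toSpanSingleton ℝ c).comp_condExp_comm (m := 𝒢 n) h1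
    have h5 : (ContinuousLinearMap.toSpanSingleton ℝ c) ∘ (s.indicator fun _ => (1 : ℝ)) =
        s.indicator fun _ => c := by
      ext ω
      by_cases h : ω ∈ s <;> simp [h]
    rw [h5] at h4
    filter_upwards [h4] with ω hω
    rw [Pi.sub_apply, ← hω, ← h5, Pi.sub_apply, Function.comp_apply, Function.comp_apply,
      ← map_sub, ContinuousLinearMap.toSpanSingleton_apply, norm_smul, mul_comm]
  · intro f g _ hf hg _ _ h1 h2
    rw [memLp_one_iff_integrable] at hf hg
    refine tendsto_of_tendsto_of_tendsto_of_le_of_le tendsto_const_nhds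
      (by simpa using h1.add h2) (fun _ => zero_le) fun n => ?_
    refine le_trans (eLpNorm_congr_ae ?_).le (eLpNorm_add_le
      (integrable_condExp.sub hf).1 (integrable_condExp.sub hg).1 le_rfl)
    filter_upwards [condExp_add hf hg (𝒢 n)] with ω hω
    simp only [Pi.sub_apply, Pi.add_apply, hω]
    abel
  · refine isClosed_of_closure_subset fun f hf => ?_
    have hfi : Integrable (f : Lp F 1 μ) μ := L1.integrable_coeFn _
    refine ENNReal.tendsto_nhds_zero.2 fun ε hε => ?_
    obtain ⟨g, hg, hd⟩ := EMetric.mem_closure_iff.1 hf (ε / 3) (ENNReal.div_pos hε.ne' (by simp))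
    have hgi : Integrable (g : Lp F 1 μ) μ := L1.integrable_coeFn _
    have hd' : eLpNorm ((f : Lp F 1 μ) - (g : Lp F 1 μ) : X → F) 1 μ ≤ ε / 3 := by
      have : edist (f : Lp F 1 μ) (g : Lp F 1 μ) < ε / 3 := hd
      rw [Lp.edist_def] at this
      exact this.le
    filter_upwards [ENNReal.tendsto_nhds_zero.1 hg (ε / 3) (ENNReal.div_pos hε.ne' (by simp))]
      with n hn
    have h1 : (μ[(f : Lp F 1 μ) | 𝒢 n] - (f : Lp F 1 μ) : X → F) =ᵐ[μ]
        μ[((f : Lp F 1 μ) - (g : Lp F 1 μ) : X → F) | 𝒢 n] +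
          ((μ[(g : Lp F 1 μ) | 𝒢 n] - (g : Lp F 1 μ) : X → F) -
          ((f : Lp F 1 μ) - (g : Lp F 1 μ) : X → F)) := by
      filter_upwards [condExp_sub hfi hgi (𝒢 n)] with ω hω
      simp only [Pi.sub_apply, Pi.add_apply, hω]
      abel
    rw [eLpNorm_congr_ae h1]
    refine (eLpNorm_add_le integrable_condExp.1
      ((integrable_condExp.sub hgi).sub (hfi.sub hgi)).1 le_rfl).trans ?_
    refine (add_le_add_right (eLpNorm_sub_le (integrable_condExp.sub hgi).1
      (hfi.sub hgi).1 le_rfl) _).trans ?_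
    refine (add_le_add ((eLpNorm_condExp_le_eLpNorm _ le_rfl).trans hd') (add_le_add hn hd')).trans ?_
    rw [← add_assoc, ENNReal.add_thirds]
  · intro f g hfg hf h
    refine h.congr fun n => eLpNorm_congr_ae ?_
    exact (condExp_congr_ae hfg).sub hfg

end VectorIntegration

section UniformIntegrability

variable {X : Type u} {mX : MeasurableSpace X} {μ : Measure X}

theorem unifIntegrable_of_norm_le {ι F F' : Type*} [NormedAddCommGroup F] [NormedAddCommGroup F']
    {H : ι → X → F} {f : ι → X → F'} (hH : UnifIntegrable H 1 μ) {C : ℝ}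
    (h : ∀ i, ∀ᵐ ω ∂μ, ‖f i ω‖ ≤ C * ‖H i ω‖) : UnifIntegrable f 1 μ := by
  intro ε hε
  obtain ⟨δ, hδ, hs⟩ := hH (div_pos hε (by positivity : 0 < |C| + 1))
  refine ⟨δ, hδ, fun i s hsm hμ => ?_⟩
  have h1 : eLpNorm (s.indicator (f i)) 1 μ ≤
      ENNReal.ofReal (|C| + 1) * eLpNorm (s.indicator (H i)) 1 μ := by
    refine eLpNorm_le_mul_eLpNorm_of_ae_le_mul ?_ 1
    filter_upwards [h i] with ω hω
    by_cases hωs : ω ∈ s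
    · rw [indicator_of_mem hωs, indicator_of_mem hωs]
      refine hω.trans (mul_le_mul_of_nonneg_right ?_ (norm_nonneg _))
      linarith [le_abs_self C]
    · simp [hωs]
  refine h1.trans ((mul_le_mul_right (hs i s hsm hμ) _).trans_eq ?_)
  rw [← ENNReal.ofReal_mul (by positivity), mul_div_cancel₀ _ (by positivity)]

/-- Bounded functions tending to zero in measure tend to zero uniformly when they are integrated
against a bounded and uniformly integrable family. -/
theorem eventually_lintegral_mul_le {ι F F' : Type*} [NormedAddCommGroup F] [NormedAddCommGroup F']
    {H : ι → X → F} (hH : UnifIntegrable H 1 μ) {R : ℝ≥0} (hR : ∀ i, eLpNorm (H i) 1 μ ≤ R)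
    (hHm : ∀ i, AEStronglyMeasurable (H i) μ)
    {D : ℕ → X → F'} (hDm : ∀ n, StronglyMeasurable (D n)) {C : ℝ}
    (hC : ∀ n, ∀ᵐ ω ∂μ, ‖D n ω‖ ≤ C) (hD : TendstoInMeasure μ D atTop fun _ => 0)
    {ε : ℝ} (hε : 0 < ε) :
    ∀ᶠ n in atTop, ∀ i, ∫⁻ ω, ‖D n ω‖ₑ * ‖H i ω‖ₑ ∂μ ≤ ENNReal.ofReal ε := by
  set η : ℝ := ε / (2 * (R + 1)) with hη
  have hη0 : 0 < η := by positivity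
  obtain ⟨δ, hδ, hs⟩ := hH (div_pos hε (by positivity : 0 < 2 * (|C| + 1)))
  rw [tendstoInMeasure_iff_norm] at hD
  filter_upwards [(hD η hη0).eventually_le_const (ENNReal.ofReal_pos.2 hδ)] with n hn i
  simp only [sub_zero] at hn
  set S := {ω | η ≤ ‖D n ω‖} with hS
  have hSm : MeasurableSet S := (hDm n).norm.measurable measurableSet_Ici
  have h1 := hs i S hSm hn
  have h2 : ∫⁻ ω, ‖D n ω‖ₑ * ‖H i ω‖ₑ ∂μ ≤
      ENNReal.ofReal (|C| + 1) * eLpNorm (S.indicator (H i)) 1 μ +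
        ENNReal.ofReal η * eLpNorm (H i) 1 μ := by
    rw [eLpNorm_one_eq_lintegral_enorm, eLpNorm_one_eq_lintegral_enorm,
      ← lintegral_const_mul' _ _ ENNReal.ofReal_ne_top,
      ← lintegral_const_mul' _ _ ENNReal.ofReal_ne_top,
      ← lintegral_add_right' _ ((hHm i).enorm.const_mul _)]
    refine lintegral_mono_ae ?_
    filter_upwards [hC n] with ω hω
    rw [← ofReal_norm (D n ω)]
    by_cases hωS : ω ∈ S
    · rw [indicator_of_mem hωS]
      refine le_trans (mul_le_mul_left (ENNReal.ofReal_le_ofReal ?_) _) le_self_add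
      linarith [le_abs_self C]
    · refine le_trans (mul_le_mul_left (ENNReal.ofReal_le_ofReal ?_) _) le_add_self
      exact le_of_lt (not_le.1 hωS)
  refine h2.trans ((add_le_add (mul_le_mul_right h1 _) (mul_le_mul_right (hR i) _)).trans ?_)
  rw [← ENNReal.ofReal_coe_nnreal, ← ENNReal.ofReal_mul (by positivity),
    ← ENNReal.ofReal_mul hη0.le, ← ENNReal.ofReal_add (by positivity) (by positivity)]
  refine ENNReal.ofReal_le_ofReal ?_
  have h3 : (|C| + 1) * (ε / (2 * (|C| + 1))) = ε / 2 := by field_simp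
  have h4 : η * R ≤ ε / 2 := by
    have : η * (R + 1) = ε / 2 := by rw [hη]; field_simp
    nlinarith
  linarith

variable {E : Type v} [NormedAddCommGroup E] [NormedSpace ℝ E]

theorem integrable_dual_apply {g : X → StrongDual ℝ E} {f : X → E}
    (hg : AEStronglyMeasurable g μ) {C : ℝ} (hC : ∀ᵐ ω ∂μ, ‖g ω‖ ≤ C) (hf : Integrable f μ) :
    Integrable (fun ω => g ω (f ω)) μ := by
  refine (hf.norm.const_mul C).mono
    (isBoundedBilinearMap_apply.continuous.comp_aestronglyMeasurable (hg.prodMk hf.1)) ?_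
  filter_upwards [hC] with ω hω
  rw [norm_mul, norm_norm]
  exact (ContinuousLinearMap.le_opNorm _ _).trans
    (mul_le_mul_of_nonneg_right (hω.trans (le_abs_self C)) (norm_nonneg _))

variable [IsFiniteMeasure μ]

theorem integral_condExp_apply {m : MeasurableSpace X} (hm : m ≤ mX) {g : X → StrongDual ℝ E}
    {f : X → E} (hg : Integrable g μ) {C : ℝ} (hC : ∀ᵐ ω ∂μ, ‖g ω‖ ≤ C) (hf : Integrable f μ)
    (hfm : AEStronglyMeasurable[m] f μ) :
    ∫ ω, (μ[g | m]) ω (f ω) ∂μ = ∫ ω, g ω (f ω) ∂μ := by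
  rw [← integral_condExp hm (f := fun ω => g ω (f ω))]
  refine integral_congr_ae (EventuallyEq.symm ?_)
  exact condExp_bilin_of_aestronglyMeasurable_right (ContinuousLinearMap.id ℝ (StrongDual ℝ E)) hfm
    (integrable_dual_apply hg.1 hC hf) hg

variable [CompleteSpace E]

theorem integral_apply_condExp {m : MeasurableSpace X} (hm : m ≤ mX) {g : X → StrongDual ℝ E}
    {f : X → E} {C : ℝ} (hC : ∀ᵐ ω ∂μ, ‖g ω‖ ≤ C) (hf : Integrable f μ)
    (hgm : StronglyMeasurable[m] g) :
    ∫ ω, g ω ((μ[f | m]) ω) ∂μ = ∫ ω, g ω (f ω) ∂μ := by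
  rw [← integral_condExp hm (f := fun ω => g ω (f ω))]
  refine integral_congr_ae (EventuallyEq.symm ?_)
  exact condExp_bilin_of_stronglyMeasurable_left (ContinuousLinearMap.id ℝ (StrongDual ℝ E)) hgm
    (integrable_dual_apply (hgm.mono hm).aestronglyMeasurable hC hf) hf

/-- If the conditional expectations of the `ξ k` given each `𝒢 n` tend weakly to zero almost
everywhere, subject to a uniformly integrable bound, then the `ξ k` integrate to zero in the limit
against each bounded function with values in `E'`. -/
theorem tendsto_integral_dual_apply (𝒢 : Filtration ℕ mX) {ξ : ℕ → X → E}
    (hξ : ∀ k, Integrable (ξ k) μ) (hξm : ∀ k, AEStronglyMeasurable[⨆ n, 𝒢 n] (ξ k) μ)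
    {H : ℕ → X → ℝ} (hH : UnifIntegrable H 1 μ) {R : ℝ≥0} (hR : ∀ k, eLpNorm (H k) 1 μ ≤ R)
    (hHm : ∀ k, AEStronglyMeasurable (H k) μ)
    (hle : ∀ n k, ∀ᵐ ω ∂μ, ‖(μ[ξ k | 𝒢 n]) ω‖ ≤ ‖H k ω‖)
    (hlim : ∀ n, ∀ᵐ ω ∂μ, ∀ f : StrongDual ℝ E,
      Tendsto (fun k => f ((μ[ξ k | 𝒢 n]) ω)) atTop (𝓝 0))
    {g : X → StrongDual ℝ E} (hg : Integrable g μ) {C : ℝ} (hC : ∀ᵐ ω ∂μ, ‖g ω‖ ≤ C) :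
    Tendsto (fun k => ∫ ω, g ω (ξ k ω) ∂μ) atTop (𝓝 0) := by
  have hm : (⨆ n, 𝒢 n) ≤ mX := iSup_le fun n => 𝒢.le n
  have hξle : ∀ k, ∀ᵐ ω ∂μ, ‖ξ k ω‖ ≤ ‖H k ω‖ := by
    intro k
    have h1 : TendstoInMeasure μ (fun n => μ[ξ k | 𝒢 n]) atTop (ξ k) :=
      tendstoInMeasure_of_tendsto_eLpNorm one_ne_zero (fun n => integrable_condExp.1) (hξ k).1
        (tendsto_eLpNorm_condExp_sub 𝒢 (hξ k) (hξm k))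
    obtain ⟨ns, -, hns⟩ := h1.exists_seq_tendsto_ae
    filter_upwards [hns, ae_all_iff.2 fun n => hle n k] with ω h2 h3
    exact le_of_tendsto h2.norm (Eventually.of_forall fun i => h3 (ns i))
  have hCn : ∀ m : MeasurableSpace X, ∀ᵐ ω ∂μ, ‖(μ[g | m]) ω‖ ≤ C := fun m =>
    ae_bdd_norm_condExp_of_ae_bdd_norm hC
  have hlevel : ∀ n, Tendsto (fun k => ∫ ω, (μ[g | 𝒢 n]) ω (ξ k ω) ∂μ) atTop (𝓝 0) := by
    intro n
    have h1 : Tendsto (fun k => eLpNorm ((fun ω => (μ[g | 𝒢 n]) ω ((μ[ξ k | 𝒢 n]) ω)) - 0) 1 μ)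
        atTop (𝓝 0) := by
      refine tendsto_Lp_finite_of_tendsto_ae le_rfl ENNReal.one_ne_top
        (fun k => (integrable_dual_apply integrable_condExp.1 (hCn _) integrable_condExp).1)
        MemLp.zero (unifIntegrable_of_norm_le (C := |C|) hH fun k => ?_) ?_
      · filter_upwards [hCn (𝒢 n), hle n k] with ω h2 h3
        refine (ContinuousLinearMap.le_opNorm _ _).trans
          (mul_le_mul (h2.trans (le_abs_self C)) h3 (norm_nonneg _) (abs_nonneg _))
      · filter_upwards [hlim n] with ω hω using hω _
    refine squeeze_zero_norm (fun k => ?_)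
      ((ENNReal.tendsto_toReal ENNReal.zero_ne_top).comp h1)
    rw [← integral_apply_condExp (𝒢.le n) (hCn _) (hξ k) stronglyMeasurable_condExp,
      Function.comp_apply, sub_zero, eLpNorm_one_eq_lintegral_enorm,
      ← integral_norm_eq_lintegral_enorm
        (integrable_dual_apply integrable_condExp.1 (hCn _) integrable_condExp).1]
    exact norm_integral_le_integral_norm _
  have hgn : TendstoInMeasure μ (fun n => μ[g | 𝒢 n] - μ[g | ⨆ n, 𝒢 n]) atTop fun _ => 0 := by
    refine tendstoInMeasure_of_tendsto_eLpNorm one_ne_zero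
      (fun n => (integrable_condExp.sub integrable_condExp).1) aestronglyMeasurable_const ?_
    refine (tendsto_eLpNorm_condExp_sub 𝒢 (integrable_condExp (f := g))
      stronglyMeasurable_condExp.aestronglyMeasurable).congr fun n => eLpNorm_congr_ae ?_
    filter_upwards [condExp_condExp_of_le (f := g) (le_iSup 𝒢 n) hm] with ω hω
    simp [hω]
  rw [Metric.tendsto_nhds]
  intro ε hε
  obtain ⟨n, hn⟩ := (eventually_lintegral_mul_le hH hR hHm
    (fun n => (stronglyMeasurable_condExp.mono (𝒢.le n)).sub (stronglyMeasurable_condExp.mono hm))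
    (C := C + C) (fun n => by
      filter_upwards [hCn (𝒢 n), hCn (⨆ n, 𝒢 n)] with ω h1 h2
      exact (norm_sub_le _ _).trans (add_le_add h1 h2)) hgn (half_pos hε)).exists
  filter_upwards [Metric.tendsto_nhds.1 (hlevel n) (ε / 2) (half_pos hε)] with k hk
  rw [dist_zero_right] at hk ⊢
  have h1 : ∫ ω, g ω (ξ k ω) ∂μ = ∫ ω, (μ[g | 𝒢 n]) ω (ξ k ω) ∂μ -
      ∫ ω, ((μ[g | 𝒢 n] - μ[g | ⨆ n, 𝒢 n]) ω) (ξ k ω) ∂μ := by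
    rw [← integral_condExp_apply hm hg hC (hξ k) (hξm k), ← integral_sub]
    · simp
    · exact integrable_dual_apply integrable_condExp.1 (hCn _) (hξ k)
    · refine integrable_dual_apply (integrable_condExp.sub integrable_condExp).1 (C := C + C) ?_
        (hξ k)
      filter_upwards [hCn (𝒢 n), hCn (⨆ n, 𝒢 n)] with ω h1 h2
      exact (norm_sub_le _ _).trans (add_le_add h1 h2)
  have h2 : ‖∫ ω, ((μ[g | 𝒢 n] - μ[g | ⨆ n, 𝒢 n]) ω) (ξ k ω) ∂μ‖ ≤ ε / 2 := by
    rw [← ENNReal.ofReal_le_ofReal_iff (half_pos hε).le, ofReal_norm]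
    refine (enorm_integral_le_lintegral_enorm _).trans (le_trans (lintegral_mono_ae ?_) (hn k))
    filter_upwards [hξle k] with ω hω
    refine (ContinuousLinearMap.le_opENorm _ _).trans (mul_le_mul_right ?_ _)
    rw [← ofReal_norm, ← ofReal_norm]
    exact ENNReal.ofReal_le_ofReal hω
  rw [h1]
  exact (norm_sub_le _ _).trans_lt (by linarith)

end UniformIntegrability

section Doob

variable {X : Type u} {mX : MeasurableSpace X} {μ : Measure X} {𝓕 : Filtration ℝ≥0 mX}
  {E : Type v} [NormedAddCommGroup E] [NormedSpace ℝ E] [CompleteSpace E]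

theorem setLIntegral_enorm_condExp_le {m : MeasurableSpace X} {ζ : X → E}
    (hζ : Integrable ζ μ) {A : Set X} (hA : MeasurableSet[m] A) :
    ∫⁻ ω in A, ‖(μ[ζ | m]) ω‖ₑ ∂μ ≤ ∫⁻ ω in A, ‖ζ ω‖ₑ ∂μ := by
  rw [← ofReal_integral_norm_eq_lintegral_enorm integrable_condExp.integrableOn,
    ← ofReal_integral_norm_eq_lintegral_enorm hζ.integrableOn]
  exact ENNReal.ofReal_le_ofReal (setIntegral_norm_condExp_le hA ζ)

/-- **Doob's maximal inequality** for the maximum of a closed martingale over finitely many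
times. -/
theorem mul_measure_biUnion_lt_enorm_le {M : ℝ≥0 → X → E} {ζ : X → E} (hζ : Integrable ζ μ)
    (hM : ∀ t, StronglyMeasurable[𝓕 t] (M t)) (hMζ : ∀ t, M t =ᵐ[μ] μ[ζ | 𝓕 t]) (lam : ℝ≥0∞)
    (s : Finset ℝ≥0) :
    lam * μ (⋃ t ∈ s, {ω | lam < ‖M t ω‖ₑ}) ≤
      ∫⁻ ω in ⋃ t ∈ s, {ω | lam < ‖M t ω‖ₑ}, ‖ζ ω‖ₑ ∂μ := by
  have hmeas : ∀ t, MeasurableSet[𝓕 t] {ω | lam < ‖M t ω‖ₑ} := fun t =>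
    (hM t).enorm measurableSet_Ioi
  induction s using Finset.induction_on_max with
  | empty => simp
  | insert a s ha ih =>
    set U := ⋃ t ∈ s, {ω | lam < ‖M t ω‖ₑ} with hU
    have hUa : MeasurableSet[𝓕 a] U :=
      Finset.measurableSet_biUnion s fun t ht => 𝓕.mono (ha t ht).le _ (hmeas t)
    have hD : MeasurableSet[𝓕 a] ({ω | lam < ‖M a ω‖ₑ} \ U) := (hmeas a).diff hUa
    have hD' := 𝓕.le a _ hD
    have hsplit : ⋃ t ∈ insert a s, {ω | lam < ‖M t ω‖ₑ} = U ∪ ({ω | lam < ‖M a ω‖ₑ} \ U) := by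
      rw [Finset.set_biUnion_insert, union_sdiff_self, union_comm]
    rw [hsplit, measure_union disjoint_sdiff_self_right hD',
      lintegral_union hD' disjoint_sdiff_self_right, mul_add]
    refine add_le_add ih (le_trans ?_ (setLIntegral_enorm_condExp_le hζ hD))
    have h1 : (fun ω => ‖M a ω‖ₑ) =ᵐ[μ] fun ω => ‖(μ[ζ | 𝓕 a]) ω‖ₑ :=
      (hMζ a).mono fun ω h => congrArg _ h
    rw [← lintegral_congr_ae (ae_restrict_of_ae h1), ← setLIntegral_const]
    exact setLIntegral_mono' hD' fun ω hω => le_of_lt hω.1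

/-- **Doob's maximal inequality** for closed càdlàg martingales. -/
theorem mul_measure_lt_maximalFunction_le {M : ℝ≥0 → X → E} {ζ : X → E} (hζ : Integrable ζ μ)
    (hM : ∀ t, StronglyMeasurable[𝓕 t] (M t)) (hc : IsCadlag M)
    (hMζ : ∀ t, M t =ᵐ[μ] μ[ζ | 𝓕 t]) (lam : ℝ≥0∞) :
    lam * μ {ω | lam < maximalFunction M ω} ≤ ∫⁻ ω, ‖ζ ω‖ₑ ∂μ := by
  classical
  let d := TopologicalSpace.denseSeq ℝ≥0
  let A : ℕ → Set X := fun n => ⋃ t ∈ (Finset.range n).image d, {ω | lam < ‖M t ω‖ₑ}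
  have hA : Monotone A := fun m n hmn =>
    biUnion_subset_biUnion_left fun t ht =>
      Finset.image_subset_image (Finset.range_mono hmn) ht
  have hU : {ω | lam < maximalFunction M ω} = ⋃ n, A n := by
    ext ω
    simp only [mem_ofPred_eq, maximalFunction_eq_iSup_dense hc, lt_iSup_iff, mem_iUnion, A,
      Finset.mem_image, Finset.mem_range]
    constructor
    · rintro ⟨n, hn⟩
      exact ⟨n + 1, d n, ⟨n, n.lt_succ_self, rfl⟩, hn⟩
    · rintro ⟨_, _, ⟨n, -, rfl⟩, hn⟩
      exact ⟨n, hn⟩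
  rw [hU, hA.measure_iUnion, ENNReal.mul_iSup]
  exact iSup_le fun n => (mul_measure_biUnion_lt_enorm_le hζ hM hMζ lam _).trans
    (setLIntegral_le_lintegral _ _)

end Doob

namespace HardySpace

variable {X : Type u} {mX : MeasurableSpace X} {𝓕 : Filtration ℝ≥0 mX} {μ : Measure X}
  {E : Type v} [NormedAddCommGroup E] [NormedSpace ℝ E] [CompleteSpace E]

theorem process_add (M N : HardySpace 𝓕 μ E) :
    ∀ᵐ ω ∂μ, ∀ t, (M + N).process t ω = M.process t ω + N.process t ω := by
  have h := process_mk (Quotient.out M + Quotient.out N)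
  have he : (SeparationQuotient.mk (Quotient.out M + Quotient.out N) : HardySpace 𝓕 μ E) = M + N := by
    rw [SeparationQuotient.mk_add]
    exact congrArg₂ (· + ·) (Quotient.out_eq M) (Quotient.out_eq N)
  rw [he] at h
  filter_upwards [h] with ω hω t
  rw [hω t, map_add]
  rfl

theorem process_smul (c : ℝ) (M : HardySpace 𝓕 μ E) :
    ∀ᵐ ω ∂μ, ∀ t, (c • M).process t ω = c • M.process t ω := by
  have h := process_mk (c • Quotient.out M)
  have he : (SeparationQuotient.mk (c • Quotient.out M) : HardySpace 𝓕 μ E) = c • M := by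
    rw [SeparationQuotient.mk_smul]
    exact congrArg (c • ·) (Quotient.out_eq M)
  rw [he] at h
  filter_upwards [h] with ω hω t
  rw [hω t, map_smul]
  rfl

theorem process_sub (M N : HardySpace 𝓕 μ E) :
    ∀ᵐ ω ∂μ, ∀ t, (M - N).process t ω = M.process t ω - N.process t ω := by
  filter_upwards [process_add (M - N) N] with ω h t
  rw [eq_sub_iff_add_eq, ← h t, sub_add_cancel]

theorem setLIntegral_maximalFunction_lt_top (B : Set X) (M : HardySpace 𝓕 μ E) :
    ∫⁻ ω in B, maximalFunction M.process ω ∂μ < ∞ :=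
  (setLIntegral_le_lintegral _ _).trans_lt M.isHardyMartingale_process.lintegral_lt_top

theorem maximalFunction_process_lt_top (M : HardySpace 𝓕 μ E) :
    ∀ᵐ ω ∂μ, maximalFunction M.process ω < ∞ :=
  ae_lt_top M.isHardyMartingale_process.measurable_maximalFunction
    M.isHardyMartingale_process.lintegral_lt_top.ne

/-- The seminorm `M ↦ ∫_B M*_∞ dμ`. -/
noncomputable def setSeminorm (B : Set X) : Seminorm ℝ (HardySpace 𝓕 μ E) :=
  Seminorm.of (fun M => (∫⁻ ω in B, maximalFunction M.process ω ∂μ).toReal)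
    (fun M N => by
      rw [← ENNReal.toReal_add (setLIntegral_maximalFunction_lt_top B M).ne
        (setLIntegral_maximalFunction_lt_top B N).ne, ← lintegral_add_left
          M.isHardyMartingale_process.measurable_maximalFunction]
      refine ENNReal.toReal_mono ?_ (lintegral_mono_ae (ae_restrict_of_ae ?_))
      · rw [lintegral_add_left M.isHardyMartingale_process.measurable_maximalFunction]
        exact (ENNReal.add_lt_top.2 ⟨setLIntegral_maximalFunction_lt_top B M,
          setLIntegral_maximalFunction_lt_top B N⟩).ne
      · filter_upwards [process_add M N] with ω hω
        refine le_trans (le_of_eq ?_) (maximalFunction_add_le M.process N.process ω)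
        exact iSup_congr fun t => by rw [hω t]; rfl)
    (fun c M => by
      rw [← toReal_enorm, ← ENNReal.toReal_mul, ← lintegral_const_mul' _ _ (by simp)]
      congr 1
      refine lintegral_congr_ae (ae_restrict_of_ae ?_)
      filter_upwards [process_smul c M] with ω hω
      rw [← maximalFunction_smul]
      exact iSup_congr fun t => by rw [hω t]; rfl)

theorem setSeminorm_apply (B : Set X) (M : HardySpace 𝓕 μ E) :
    setSeminorm B M = (∫⁻ ω in B, maximalFunction M.process ω ∂μ).toReal := rfl

theorem ofReal_setSeminorm (B : Set X) (M : HardySpace 𝓕 μ E) :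
    ENNReal.ofReal (setSeminorm B M) = ∫⁻ ω in B, maximalFunction M.process ω ∂μ :=
  ENNReal.ofReal_toReal (setLIntegral_maximalFunction_lt_top B M).ne

theorem setSeminorm_univ (M : HardySpace 𝓕 μ E) : setSeminorm univ M = ‖M‖ := by
  rw [setSeminorm_apply, norm_eq, Measure.restrict_univ]

theorem setSeminorm_le_norm (B : Set X) (M : HardySpace 𝓕 μ E) : setSeminorm B M ≤ ‖M‖ := by
  rw [norm_eq]
  exact ENNReal.toReal_mono M.isHardyMartingale_process.lintegral_lt_top.ne
    (setLIntegral_le_lintegral _ _)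

theorem setSeminorm_le_add {A B C : Set X} (h : A ⊆ B ∪ C) (M : HardySpace 𝓕 μ E) :
    setSeminorm A M ≤ setSeminorm B M + setSeminorm C M := by
  rw [setSeminorm_apply, setSeminorm_apply, setSeminorm_apply,
    ← ENNReal.toReal_add (setLIntegral_maximalFunction_lt_top B M).ne
      (setLIntegral_maximalFunction_lt_top C M).ne]
  exact ENNReal.toReal_mono (ENNReal.add_lt_top.2 ⟨setLIntegral_maximalFunction_lt_top B M,
    setLIntegral_maximalFunction_lt_top C M⟩).ne
      ((lintegral_mono_set h).trans (lintegral_union_le _ _ _))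

theorem eLpNorm_indicator_maximalFunction {B : Set X} (hB : MeasurableSet B)
    (M : HardySpace 𝓕 μ E) :
    eLpNorm (B.indicator fun ω => (maximalFunction M.process ω).toReal) 1 μ =
      ENNReal.ofReal (setSeminorm B M) := by
  rw [ofReal_setSeminorm, eLpNorm_indicator_eq_eLpNorm_restrict hB, eLpNorm_one_eq_lintegral_enorm]
  refine lintegral_congr_ae (ae_restrict_of_ae ?_)
  filter_upwards [M.maximalFunction_process_lt_top] with ω hω
  rw [Real.enorm_of_nonneg ENNReal.toReal_nonneg, ENNReal.ofReal_toReal hω.ne]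

theorem eLpNorm_maximalFunction (M : HardySpace 𝓕 μ E) :
    eLpNorm (fun ω => (maximalFunction M.process ω).toReal) 1 μ = ENNReal.ofReal ‖M‖ := by
  rw [← setSeminorm_univ, ← eLpNorm_indicator_maximalFunction .univ, indicator_univ]

theorem aestronglyMeasurable_maximalFunction (M : HardySpace 𝓕 μ E) :
    AEStronglyMeasurable (fun ω => (maximalFunction M.process ω).toReal) μ :=
  M.isHardyMartingale_process.measurable_maximalFunction.ennreal_toReal.aestronglyMeasurable

theorem unifIntegrable_maximalFunction_iff {ι : Type*} {M : ι → HardySpace 𝓕 μ E} :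
    UnifIntegrable (fun i ω => (maximalFunction (M i).process ω).toReal) 1 μ ↔
      ∀ ε : ℝ, 0 < ε → ∃ δ : ℝ, 0 < δ ∧ ∀ i s, MeasurableSet s → μ s ≤ ENNReal.ofReal δ →
        setSeminorm s (M i) ≤ ε := by
  refine forall₂_congr fun ε hε => exists_congr fun δ => ?_
  rw [exists_prop]
  refine and_congr_right fun _ => forall₄_congr fun i s hs _ => ?_
  rw [eLpNorm_indicator_maximalFunction hs, ENNReal.ofReal_le_ofReal_iff hε.le]

theorem exists_dual_le_setSeminorm (B : Set X) (M : HardySpace 𝓕 μ E) :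
    ∃ f : StrongDual ℝ (HardySpace 𝓕 μ E), f M = setSeminorm B M ∧
      ∀ N, |f N| ≤ setSeminorm B N := by
  obtain ⟨g, hg1, hg2⟩ : ∃ g : HardySpace 𝓕 μ E →ₗ[ℝ] ℝ, g M = setSeminorm B M ∧
      ∀ N, g N ≤ setSeminorm B N := by
    by_cases hM : M = 0
    · exact ⟨0, by simp [hM], fun N => by simp⟩
    obtain ⟨g, hg1, hg2⟩ := exists_extension_of_le_sublinear
      (LinearPMap.mkSpanSingleton M (setSeminorm B M) hM) (setSeminorm B)
      (fun c hc N => by rw [map_smul_eq_mul, Real.norm_of_nonneg hc.le])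
      (map_add_le_add _) (by
        rintro ⟨x, hx⟩
        obtain ⟨c, rfl⟩ := Submodule.mem_span_singleton.1 hx
        refine (LinearPMap.mkSpanSingleton'_apply M _ _ c hx).trans_le ?_
        rw [map_smul_eq_mul, smul_eq_mul]
        exact mul_le_mul_of_nonneg_right (le_abs_self c) (apply_nonneg _ _))
    refine ⟨g, ?_, hg2⟩
    exact (hg1 ⟨M, Submodule.mem_span_singleton_self M⟩).trans
      (LinearPMap.mkSpanSingleton'_apply_self M _ _ _)
  have habs : ∀ N, |g N| ≤ setSeminorm B N := fun N => abs_le'.2 ⟨hg2 N, by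
    have := hg2 (-N)
    rwa [map_neg, map_neg_eq_map] at this⟩
  exact ⟨g.mkContinuous 1 fun N => by
    rw [one_mul]
    exact (habs N).trans (setSeminorm_le_norm B N), hg1, habs⟩

theorem summable_setSeminorm {B : ℕ → Set X} (hB : ∀ n, MeasurableSet (B n))
    (hd : Pairwise (Function.onFun Disjoint B)) (M : HardySpace 𝓕 μ E) :
    (Summable fun n => setSeminorm (B n) M) ∧ ∑' n, setSeminorm (B n) M ≤ ‖M‖ := by
  have h1 : ∑' n, ∫⁻ ω in B n, maximalFunction M.process ω ∂μ =
      ∫⁻ ω in ⋃ n, B n, maximalFunction M.process ω ∂μ := (lintegral_iUnion hB hd _).symm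
  have h2 : ∑' n, ∫⁻ ω in B n, maximalFunction M.process ω ∂μ ≠ ∞ := by
    rw [h1]
    exact (setLIntegral_maximalFunction_lt_top _ M).ne
  refine ⟨ENNReal.summable_toReal h2, ?_⟩
  have h3 := ENNReal.tsum_toReal_eq fun n => (setLIntegral_maximalFunction_lt_top (B n) M).ne
  simp only [setSeminorm_apply]
  rw [← h3, h1]
  exact setSeminorm_le_norm _ M

theorem tendsto_setSeminorm_of_tendsto_measure {U : ℕ → Set X}
    (hU : Tendsto (fun n => μ (U n)) atTop (𝓝 0)) (M : HardySpace 𝓕 μ E) :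
    Tendsto (fun n => setSeminorm (U n) M) atTop (𝓝 0) :=
  (ENNReal.tendsto_toReal ENNReal.zero_ne_top).comp
    (tendsto_setLIntegral_zero M.isHardyMartingale_process.lintegral_lt_top.ne hU)

/-- The maximal functions of the elements of a relatively weakly compact subset of `H¹` are
uniformly integrable. -/
theorem uniformIntegrable_of_isRelWeaklyCompact {K : Set (HardySpace 𝓕 μ E)}
    (hK : IsRelWeaklyCompact K) :
    UniformIntegrable (fun (M : K) (ω : X) => (maximalFunction M.1.process ω).toReal) 1 μ := by
  refine ⟨fun M => M.1.aestronglyMeasurable_maximalFunction, ?_, ?_⟩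
  swap
  · obtain ⟨C, hC⟩ := hK.exists_norm_le
    refine ⟨C.toNNReal, fun M => ?_⟩
    rw [eLpNorm_maximalFunction]
    exact ENNReal.ofReal_le_ofReal (hC _ M.2)
  rw [unifIntegrable_maximalFunction_iff]
  by_contra! hcon
  obtain ⟨ε, hε, hcon⟩ := hcon
  choose Q A hA hAμ hQ using fun n : ℕ => hcon ((1 / 2) ^ n) (by positivity)
  let U : ℕ → Set X := fun n => ⋃ m, A (m + n)
  have hUμ : Tendsto (fun n => μ (U n)) atTop (𝓝 0) := by
    have hs : ∑' n, μ (A n) ≠ ∞ := by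
      refine ne_top_of_le_ne_top ?_ (ENNReal.tsum_le_tsum hAμ)
      rw [← ENNReal.ofReal_tsum_of_nonneg (fun _ => by positivity) summable_geometric_two]
      exact ENNReal.ofReal_ne_top
    exact tendsto_of_tendsto_of_tendsto_of_le_of_le tendsto_const_nhds
      (ENNReal.tendsto_sum_nat_add _ hs) (fun _ => zero_le) fun n => measure_iUnion_le _
  obtain ⟨φ, hφ, -, hφU⟩ := exists_strictMono_of_eventually
    (r := fun m n => setSeminorm (U n) (Q m).1 ≤ ε / 2)
    (fun m => (tendsto_setSeminorm_of_tendsto_measure hUμ (Q m).1).eventually_le_const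
      (half_pos hε)) 0
  let B : ℕ → Set X := fun k => A (φ k) \ U (φ (k + 1))
  have hB : ∀ k, MeasurableSet (B k) := fun k =>
    (hA _).diff (MeasurableSet.iUnion fun _ => hA _)
  have hBd : Pairwise (Function.onFun Disjoint B) := by
    refine (pairwise_disjoint_on B).2 fun i j hij => ?_
    refine disjoint_sdiff_left.mono_right (sdiff_subset.trans ?_)
    refine subset_iUnion_of_subset (φ j - φ (i + 1)) ?_
    rw [Nat.sub_add_cancel (hφ.monotone hij)]
  choose f hf1 hf2 using fun k => exists_dual_le_setSeminorm (B k) (Q (φ k)).1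
  have hsum : ∀ N : HardySpace 𝓕 μ E, Summable fun k => |f k N| := fun N =>
    (summable_setSeminorm hB hBd N).1.of_nonneg_of_le (fun _ => abs_nonneg _) fun k => hf2 k N
  refine hK.not_forall_le_apply (C := 1) hsum (fun N => ?_) (fun k => (Q (φ k)).2) (half_pos hε)
    fun k => ?_
  · rw [one_mul]
    exact ((hsum N).tsum_le_tsum (fun k => hf2 k N) (summable_setSeminorm hB hBd N).1).trans
      (summable_setSeminorm hB hBd N).2
  · rw [hf1]
    have h1 := setSeminorm_le_add (A := A (φ k)) (B := B k) (C := U (φ (k + 1)))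
      (by rw [sdiff_union_self]; exact subset_union_left) (Q (φ k)).1
    have h2 := hQ (φ k)
    have h3 := hφU k
    linarith

end HardySpace

/-- A weakly null sequence has convex combinations of arbitrarily small norm. -/
theorem exists_convexHull_norm_lt_of_tendsto_dual {V : Type*} [NormedAddCommGroup V]
    [NormedSpace ℝ V] {x : ℕ → V} (h : ∀ f : StrongDual ℝ V, Tendsto (fun k => f (x k)) atTop (𝓝 0))
    (i : ℕ) {ε : ℝ} (hε : 0 < ε) : ∃ y ∈ convexHull ℝ (x '' Ici i), ‖y‖ < ε := by
  have h1 : Tendsto (fun k => toWeakSpace ℝ V (x k)) atTop (𝓝 (toWeakSpace ℝ V 0)) := by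
    refine (WeakBilin.tendsto_iff_forall_eval_tendsto (topDualPairing ℝ V).flip
      (fun a b hab => ?_)).2 fun f => ?_
    · exact (NormedSpace.inclusionInDoubleDualLi (E := V) ℝ).injective
        (ContinuousLinearMap.ext fun f => congrArg (fun g => g f) hab)
    · have := h f
      rw [← map_zero f] at this
      exact this
  have h2 : toWeakSpace ℝ V 0 ∈ closure (toWeakSpace ℝ V '' convexHull ℝ (x '' Ici i)) := by
    refine mem_closure_of_tendsto h1 ?_
    filter_upwards [eventually_ge_atTop i] with k hk
    exact mem_image_of_mem _ (subset_convexHull ℝ _ (mem_image_of_mem _ hk))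
  rw [← (convex_convexHull ℝ _).toWeakSpace_closure ℝ] at h2
  obtain ⟨z, hz, hz0⟩ := h2
  rw [(toWeakSpace ℝ V).injective hz0] at hz
  obtain ⟨y, hy, hd⟩ := Metric.mem_closure_iff.1 hz ε hε
  exact ⟨y, hy, by rwa [dist_zero_left] at hd⟩

namespace HardySpace

variable {X : Type u} {mX : MeasurableSpace X} {𝓕 : Filtration ℝ≥0 mX} {μ : Measure X}
  {E : Type v} [NormedAddCommGroup E] [NormedSpace ℝ E] [CompleteSpace E]

/-- The integrals of the maximal functions of the elements of `S` are uniformly absolutely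
continuous. -/
def UniformlyAbsCont (S : Set (HardySpace 𝓕 μ E)) : Prop :=
  ∀ ε : ℝ, 0 < ε → ∃ δ : ℝ, 0 < δ ∧ ∀ M ∈ S, ∀ s, MeasurableSet s → μ s ≤ ENNReal.ofReal δ →
    setSeminorm s M ≤ ε

theorem UniformlyAbsCont.convexHull {S : Set (HardySpace 𝓕 μ E)} (hS : UniformlyAbsCont S) :
    UniformlyAbsCont (convexHull ℝ S) := by
  intro ε hε
  obtain ⟨δ, hδ, h⟩ := hS ε hε
  refine ⟨δ, hδ, fun M hM s hs hμ => ?_⟩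
  have := convexHull_min (t := {N | N ∈ univ ∧ setSeminorm s N ≤ ε})
    (fun N hN => ⟨mem_univ N, h N hN s hs hμ⟩)
    ((setSeminorm (𝓕 := 𝓕) (μ := μ) (E := E) s).convexOn.convex_le ε) hM
  exact this.2

theorem uniformlyAbsCont_singleton (M : HardySpace 𝓕 μ E) : UniformlyAbsCont {M} := by
  have h := unifIntegrable_maximalFunction_iff.1 (unifIntegrable_subsingleton (ι := Unit) le_rfl
    ENNReal.one_ne_top fun _ => ⟨M.aestronglyMeasurable_maximalFunction,
      (M.eLpNorm_maximalFunction).trans_lt ENNReal.ofReal_lt_top⟩)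
  intro ε hε
  obtain ⟨δ, hδ, h⟩ := h ε hε
  refine ⟨δ, hδ, fun N hN => ?_⟩
  rw [mem_singleton_iff.1 hN]
  exact h ()

theorem UniformlyAbsCont.sub {S : Set (HardySpace 𝓕 μ E)} (hS : UniformlyAbsCont S)
    (N : HardySpace 𝓕 μ E) : UniformlyAbsCont ((· - N) '' S) := by
  intro ε hε
  obtain ⟨δ, hδ, h⟩ := hS (ε / 2) (half_pos hε)
  obtain ⟨δ', hδ', h'⟩ := uniformlyAbsCont_singleton N (ε / 2) (half_pos hε)
  refine ⟨min δ δ', lt_min hδ hδ', ?_⟩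
  rintro _ ⟨M, hM, rfl⟩ s hs hμ
  have h1 := h M hM s hs (hμ.trans (ENNReal.ofReal_le_ofReal (min_le_left _ _)))
  have h2 := h' N rfl s hs (hμ.trans (ENNReal.ofReal_le_ofReal (min_le_right _ _)))
  exact (map_sub_le_add _ M N).trans (by linarith)

/-- The restriction of a filtration to the integer times. -/
def natFiltration (𝓕 : Filtration ℝ≥0 mX) : Filtration ℕ mX where
  seq n := 𝓕 n
  mono' _ _ h := 𝓕.mono (Nat.cast_le.2 h)
  le' n := 𝓕.le n

theorem exists_terminal [IsFiniteMeasure μ] (M : HardySpace 𝓕 μ E) :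
    ∃ ζ : Lp E 1 μ, AEStronglyMeasurable[⨆ n, natFiltration 𝓕 n] ζ μ ∧
      ∀ t, M.process t =ᵐ[μ] μ[ζ | 𝓕 t] := by
  obtain ⟨ξ, hξ, h⟩ := M.isHardyMartingale_process.terminal
  have hm : (⨆ n, natFiltration 𝓕 n) ≤ mX := iSup_le fun n => (natFiltration 𝓕).le n
  have hi : Integrable (μ[ξ | ⨆ n, natFiltration 𝓕 n]) μ := integrable_condExp
  refine ⟨hi.toL1 _, stronglyMeasurable_condExp.aestronglyMeasurable.congr
    (Integrable.coeFn_toL1 hi).symm, fun t => ?_⟩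
  refine (h t).trans (EventuallyEq.symm ?_)
  refine (condExp_congr_ae (Integrable.coeFn_toL1 hi)).trans (condExp_condExp_of_le ?_ hm)
  obtain ⟨n, hn⟩ := exists_nat_ge t
  exact (𝓕.mono hn).trans (le_iSup (natFiltration 𝓕) n)

theorem convex_setOf_terminal [IsFiniteMeasure μ] :
    Convex ℝ {p : HardySpace 𝓕 μ E × Lp E 1 μ | ∀ t, p.1.process t =ᵐ[μ] μ[p.2 | 𝓕 t]} := by
  rintro ⟨M, ξ⟩ hM ⟨N, η⟩ hN a b - - - t
  have hξ : Integrable ξ μ := L1.integrable_coeFn ξ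
  have hη : Integrable η μ := L1.integrable_coeFn η
  have h1 : μ[((a • ξ + b • η : Lp E 1 μ) : X → E) | 𝓕 t] =ᵐ[μ]
      a • μ[ξ | 𝓕 t] + b • μ[η | 𝓕 t] := by
    have h2 : ((a • ξ + b • η : Lp E 1 μ) : X → E) =ᵐ[μ] a • (ξ : X → E) + b • (η : X → E) :=
      (Lp.coeFn_add _ _).trans ((Lp.coeFn_smul _ _).add (Lp.coeFn_smul _ _))
    refine (condExp_congr_ae h2).trans ((condExp_add (hξ.smul a) (hη.smul b) _).trans ?_)
    exact (condExp_smul a _ _).add (condExp_smul b _ _)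
  refine EventuallyEq.trans ?_ h1.symm
  filter_upwards [process_add (a • M) (b • N), process_smul a M, process_smul b N, hM t, hN t]
    with ω h2 h3 h4 h5 h6
  change (a • M + b • N).process t ω = _
  rw [h2 t, h3 t, h4 t, h5, h6]
  rfl

theorem norm_le_of_terminal [IsFiniteMeasure μ] {M : HardySpace 𝓕 μ E} {ζ : Lp E 1 μ}
    (h : ∀ t, M.process t =ᵐ[μ] μ[ζ | 𝓕 t]) {lam δ ε : ℝ} (hlam : 0 < lam)
    (hζ : ‖ζ‖ ≤ lam * δ)
    (hM : ∀ s, MeasurableSet s → μ s ≤ ENNReal.ofReal δ → setSeminorm s M ≤ ε) :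
    ‖M‖ ≤ ε + lam * μ.real univ := by
  have hp := M.isHardyMartingale_process
  set S := {ω | ENNReal.ofReal lam < maximalFunction M.process ω} with hS
  have hSm : MeasurableSet S := hp.measurable_maximalFunction measurableSet_Ioi
  have h1 := mul_measure_lt_maximalFunction_le (L1.integrable_coeFn ζ) hp.martingale.1 hp.cadlag h
    (ENNReal.ofReal lam)
  have h2 : ∫⁻ ω, ‖ζ ω‖ₑ ∂μ ≤ ENNReal.ofReal lam * ENNReal.ofReal δ := by
    rw [← ENNReal.ofReal_mul hlam.le, ← ofReal_integral_norm_eq_lintegral_enorm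
      (L1.integrable_coeFn ζ), ← L1.norm_eq_integral_norm]
    exact ENNReal.ofReal_le_ofReal hζ
  have h3 : μ S ≤ ENNReal.ofReal δ :=
    (ENNReal.mul_le_mul_iff_right (ENNReal.ofReal_pos.2 hlam).ne' ENNReal.ofReal_ne_top).1
      (h1.trans h2)
  have h4 : setSeminorm Sᶜ M ≤ lam * μ.real univ := by
    rw [setSeminorm_apply]
    refine ENNReal.toReal_le_of_le_ofReal (by positivity) ?_
    rw [ENNReal.ofReal_mul hlam.le, ofReal_measureReal]
    refine (setLIntegral_mono' hSm.compl fun ω hω => not_lt.1 hω).trans ?_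
    rw [setLIntegral_const]
    gcongr
    exact subset_univ _
  rw [← setSeminorm_univ]
  refine (setSeminorm_le_add (B := S) (C := Sᶜ) (by rw [union_compl_self]) M).trans ?_
  exact add_le_add (hM S hSm h3) h4

/-- The terminal values of a sequence in `H¹` with uniformly integrable maximal functions which
tends weakly to zero almost everywhere at each integer time are weakly null in `L¹`. -/
theorem tendsto_dual_terminal [IsFiniteMeasure μ]
    (hE : HasRadonNikodymProperty.{u} (StrongDual ℝ E)) {P : ℕ → HardySpace 𝓕 μ E}
    (hP : UniformlyAbsCont (range P)) {C : ℝ} (hC : ∀ k, ‖P k‖ ≤ C)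
    (hlim : ∀ n : ℕ, ∀ᵐ ω ∂μ, ∀ f : StrongDual ℝ E,
      Tendsto (fun k => f ((P k).process n ω)) atTop (𝓝 0)) {ζ : ℕ → Lp E 1 μ}
    (hζm : ∀ k, AEStronglyMeasurable[⨆ n, natFiltration 𝓕 n] (ζ k) μ)
    (hζ : ∀ k t, (P k).process t =ᵐ[μ] μ[ζ k | 𝓕 t]) (f : StrongDual ℝ (Lp E 1 μ)) :
    Tendsto (fun k => f (ζ k)) atTop (𝓝 0) := by
  obtain ⟨g, hg, hgC, hgf⟩ := hE.exists_density f
  simp only [hgf]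
  refine tendsto_integral_dual_apply (natFiltration 𝓕) (fun k => L1.integrable_coeFn _) hζm
    (H := fun k ω => (maximalFunction (P k).process ω).toReal) ?_ (R := C.toNNReal) (fun k => ?_)
    (fun k => (P k).aestronglyMeasurable_maximalFunction) (fun n k => ?_) (fun n => ?_) hg hgC
  · refine unifIntegrable_maximalFunction_iff.2 fun ε hε => ?_
    obtain ⟨δ, hδ, h⟩ := hP ε hε
    exact ⟨δ, hδ, fun k => h _ (mem_range_self k)⟩
  · rw [eLpNorm_maximalFunction]
    exact ENNReal.ofReal_le_ofReal (hC k)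
  · filter_upwards [hζ k n, (P k).maximalFunction_process_lt_top] with ω h1 h2
    change ‖(μ[ζ k | 𝓕 n]) ω‖ ≤ _
    rw [← h1, Real.norm_of_nonneg ENNReal.toReal_nonneg, ← toReal_enorm]
    exact ENNReal.toReal_mono h2.ne (le_iSup (fun t => ‖(P k).process t ω‖ₑ) (n : ℝ≥0))
  · filter_upwards [hlim n, ae_all_iff.2 fun k => hζ k n] with ω h1 h2 f
    refine (h1 f).congr fun k => ?_
    rw [h2 k]
    rfl

theorem exists_mem_convexHull_terminal [IsFiniteMeasure μ] {P : ℕ → HardySpace 𝓕 μ E}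
    {ζ : ℕ → Lp E 1 μ} (hζ : ∀ k t, (P k).process t =ᵐ[μ] μ[ζ k | 𝓕 t]) {s : Set ℕ}
    {y : Lp E 1 μ} (hy : y ∈ convexHull ℝ (ζ '' s)) :
    ∃ Q ∈ convexHull ℝ (P '' s), ∀ t, Q.process t =ᵐ[μ] μ[y | 𝓕 t] := by
  have himage : ζ '' s = LinearMap.snd ℝ (HardySpace 𝓕 μ E) (Lp E 1 μ) ''
      ((fun k => (P k, ζ k)) '' s) := by
    simp only [image_image, LinearMap.snd_apply]
  rw [himage, ← LinearMap.image_convexHull] at hy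
  obtain ⟨⟨Q, y⟩, hQy, rfl⟩ := hy
  refine ⟨Q, ?_, ?_⟩
  · have := mem_image_of_mem (LinearMap.fst ℝ (HardySpace 𝓕 μ E) (Lp E 1 μ)) hQy
    rwa [LinearMap.image_convexHull, image_image] at this
  · have hsub : (fun k => (P k, ζ k)) '' s ⊆
        {p : HardySpace 𝓕 μ E × Lp E 1 μ | ∀ t, p.1.process t =ᵐ[μ] μ[p.2 | 𝓕 t]} := by
      rintro _ ⟨k, -, rfl⟩
      exact hζ k
    exact convexHull_min hsub convex_setOf_terminal hQy

/-- If the elements of a sequence in `H¹` with uniformly integrable maximal functions tend weakly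
to zero almost everywhere at each integer time, then the sequence has convex combinations of
arbitrarily small norm. -/
theorem exists_convexHull_norm_le [IsProbabilityMeasure μ]
    (hE : HasRadonNikodymProperty.{u} (StrongDual ℝ E)) {P : ℕ → HardySpace 𝓕 μ E}
    (hP : UniformlyAbsCont (range P)) {C : ℝ} (hC : ∀ k, ‖P k‖ ≤ C)
    (hlim : ∀ n : ℕ, ∀ᵐ ω ∂μ, ∀ f : StrongDual ℝ E,
      Tendsto (fun k => f ((P k).process n ω)) atTop (𝓝 0)) (i : ℕ) {ε : ℝ} (hε : 0 < ε) :
    ∃ Q ∈ convexHull ℝ (P '' Ici i), ‖Q‖ ≤ ε := by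
  choose ζ hζm hζ using fun k => exists_terminal (P k)
  obtain ⟨δ, hδ, hQ⟩ := hP.convexHull (ε / 2) (half_pos hε)
  obtain ⟨y, hy, hyn⟩ := exists_convexHull_norm_lt_of_tendsto_dual
    (tendsto_dual_terminal hE hP hC hlim hζm hζ) i (mul_pos (half_pos hε) hδ)
  obtain ⟨Q, hQmem, hterm⟩ := exists_mem_convexHull_terminal hζ hy
  refine ⟨Q, hQmem, ?_⟩
  have := norm_le_of_terminal hterm (half_pos hε) hyn.le
    (hQ Q (convexHull_mono (image_subset_range _ _) hQmem))
  simpa using this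

theorem ucpDist_le_norm (M N : HardySpace 𝓕 μ E) :
    ucpDist μ M.process N.process ≤ ENNReal.ofReal ‖M - N‖ := by
  have h1 : ∀ n : ℕ, ∫⁻ ω, min 1 (maximalUpTo (M.process - N.process) ((n + 1 : ℕ) : ℝ≥0) ω) ∂μ ≤
      ENNReal.ofReal ‖M - N‖ := by
    intro n
    rw [← setSeminorm_univ, ofReal_setSeminorm, Measure.restrict_univ]
    refine lintegral_mono_ae ?_
    filter_upwards [process_sub M N] with ω hω
    refine (min_le_right _ _).trans (iSup₂_le fun s _ => ?_)
    rw [Pi.sub_apply, Pi.sub_apply, ← hω s]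
    exact le_iSup (fun t => ‖(M - N).process t ω‖ₑ) s
  refine (ENNReal.tsum_le_tsum fun n => mul_le_mul_right (h1 n) _).trans ?_
  rw [ENNReal.tsum_mul_right]
  have : ∑' n : ℕ, (2 : ℝ≥0∞)⁻¹ ^ (n + 1) = 1 := by
    rw [ENNReal.tsum_geometric_add_one, ENNReal.one_sub_inv_two, inv_inv]
    exact ENNReal.inv_mul_cancel two_ne_zero ENNReal.ofNat_ne_top
  rw [this, one_mul]

/-- A sequence converging fast in the topology of uniform convergence on compacts in probability
converges almost everywhere at each time. -/
theorem ae_tendsto_of_tsum_ucpDist_ne_top {N : ℕ → HardySpace 𝓕 μ E} {N' : HardySpace 𝓕 μ E}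
    (h : ∑' i, ucpDist μ (N i).process N'.process ≠ ∞) (t : ℝ≥0) :
    ∀ᵐ ω ∂μ, Tendsto (fun i => (N i).process t ω) atTop (𝓝 (N'.process t ω)) := by
  obtain ⟨n, hn⟩ := exists_nat_ge t
  have hn' : t ≤ ((n + 1 : ℕ) : ℝ≥0) := hn.trans (by exact_mod_cast n.le_succ)
  have hm : ∀ M : HardySpace 𝓕 μ E, StronglyMeasurable (M.process t) := fun M =>
    (M.isHardyMartingale_process.martingale.1 t).mono (𝓕.le t)
  have h1 : ∀ i, (2 : ℝ≥0∞)⁻¹ ^ (n + 1) *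
      ∫⁻ ω, min 1 ‖(N i).process t ω - N'.process t ω‖ₑ ∂μ ≤
        ucpDist μ (N i).process N'.process := fun i =>
    le_trans (mul_le_mul_right (lintegral_mono fun ω => min_le_min_left _
      (le_iSup₂ (f := fun s (_ : s ≤ ((n + 1 : ℕ) : ℝ≥0)) =>
        ‖((N i).process - N'.process) s ω‖ₑ) t hn')) _)
      (ENNReal.le_tsum (f := fun n : ℕ => (2 : ℝ≥0∞)⁻¹ ^ (n + 1) *
        ∫⁻ ω, min 1 (maximalUpTo ((N i).process - N'.process) ((n + 1 : ℕ) : ℝ≥0) ω) ∂μ) n)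
  have h2 := ne_top_of_le_ne_top h (ENNReal.tsum_le_tsum h1)
  rw [ENNReal.tsum_mul_left] at h2
  have h3 : ∑' i, ∫⁻ ω, min 1 ‖(N i).process t ω - N'.process t ω‖ₑ ∂μ ≠ ∞ := by
    intro h4
    rw [h4, ENNReal.mul_top (pow_ne_zero _ (by simp))] at h2
    exact h2 rfl
  have hmeas : ∀ i, Measurable fun ω => min 1 ‖(N i).process t ω - N'.process t ω‖ₑ := fun i =>
    measurable_const.min ((hm (N i)).sub (hm N')).enorm
  rw [← lintegral_tsum fun i => (hmeas i).aemeasurable] at h3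
  filter_upwards [ae_lt_top (Measurable.tsum hmeas) h3] with ω hω
  have h4 := ENNReal.tendsto_atTop_zero_of_tsum_ne_top hω.ne
  rw [tendsto_iff_edist_tendsto_0]
  refine h4.congr' ?_
  filter_upwards [h4.eventually_lt_const (zero_lt_one)] with i hi
  rw [edist_eq_enorm_sub]
  exact min_eq_right (le_of_not_ge fun h5 => absurd hi (by rw [min_eq_left h5]; exact lt_irrefl _))

end HardySpace

theorem theorem3p1 {X : Type u} {mX : MeasurableSpace X} (μ : Measure X) [IsProbabilityMeasure μ]
    (𝓕 : Filtration ℝ≥0 mX)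
    (h𝓕_zero : 𝓕 0 = MeasurableSpace.generateFrom {A : Set X | MeasurableSet A ∧ μ A = 0})
    (h𝓕_rightCont : ∀ t : ℝ≥0, 𝓕 t = ⨅ s > t, 𝓕 s)
    {E : Type v} [NormedAddCommGroup E] [NormedSpace ℝ E] [CompleteSpace E]
    (hE : HasRadonNikodymProperty.{u} (StrongDual ℝ E))
    (K : Set (HardySpace 𝓕 μ E)) :
    List.TFAE [
      IsRelWeaklyCompact K,
      UniformIntegrable (fun (M : K) (ω : X) => (maximalFunction M.1.process ω).toReal) 1 μ ∧
        ∀ M : ℕ → HardySpace 𝓕 μ E, (∀ n, M n ∈ K) →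
          ∃ N : ℕ → HardySpace 𝓕 μ E, (∀ i, N i ∈ convexHull ℝ {L | ∃ n ≥ i, L = M n}) ∧
            ∃ N' : HardySpace 𝓕 μ E,
              Tendsto (fun i => ucpDist μ (N i).process N'.process) atTop (𝓝 0),
      UniformIntegrable (fun (M : K) (ω : X) => (maximalFunction M.1.process ω).toReal) 1 μ ∧
        ∀ M : ℕ → HardySpace 𝓕 μ E, (∀ n, M n ∈ K) →
          ∃ N : ℕ → HardySpace 𝓕 μ E, (∀ i, N i ∈ convexHull ℝ {L | ∃ n ≥ i, L = M n}) ∧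
            ∃ N' : HardySpace 𝓕 μ E, ∀ t : ℝ≥0, ∀ᵐ ω ∂μ,
              Tendsto (fun i => toWeakSpace ℝ E ((N i).process t ω)) atTop
                (𝓝 (toWeakSpace ℝ E (N'.process t ω)))] := by
  tfae_have 1 → 2 := by
    intro hK
    refine ⟨HardySpace.uniformIntegrable_of_isRelWeaklyCompact hK, fun M hM => ?_⟩
    obtain ⟨N, hN, N', hlim⟩ := hK.exists_convexHull_tendsto hM
    refine ⟨N, hN, N', ?_⟩
    have h1 : Tendsto (fun i => ENNReal.ofReal ‖N i - N'‖) atTop (𝓝 0) := by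
      rw [← ENNReal.ofReal_zero]
      exact ENNReal.tendsto_ofReal (tendsto_iff_norm_sub_tendsto_zero.1 hlim)
    exact tendsto_of_tendsto_of_tendsto_of_le_of_le tendsto_const_nhds h1 (fun _ => zero_le)
      fun i => HardySpace.ucpDist_le_norm _ _
  tfae_have 2 → 3 := by
    rintro ⟨hUI, h⟩
    refine ⟨hUI, fun M hM => ?_⟩
    obtain ⟨N, hN, N', hlim⟩ := h M hM
    obtain ⟨φ, hφ, hφN⟩ := extraction_forall_of_eventually fun k : ℕ =>
      hlim.eventually_le_const (u := (2 : ℝ≥0∞)⁻¹ ^ k) (ENNReal.pow_pos (by simp) k)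
    refine ⟨N ∘ φ, fun i => ?_, N', fun t => ?_⟩
    · refine convexHull_mono ?_ (hN (φ i))
      rintro L ⟨n, hn, rfl⟩
      exact ⟨n, (hφ.id_le i).trans hn, rfl⟩
    · have hsum : ∑' i, ucpDist μ ((N ∘ φ) i).process N'.process ≠ ∞ := by
        refine ne_top_of_le_ne_top ?_ (ENNReal.tsum_le_tsum hφN)
        rw [ENNReal.tsum_geometric]
        simp
      filter_upwards [HardySpace.ae_tendsto_of_tsum_ucpDist_ne_top hsum t] with ω hω
      exact ((toWeakSpaceCLM ℝ E).continuous.tendsto _).comp hω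
  tfae_have 3 → 1 := by
    rintro ⟨⟨-, hUI, C, hC⟩, h⟩
    have hac : HardySpace.UniformlyAbsCont K := fun ε hε => by
      obtain ⟨δ, hδ, h1⟩ := HardySpace.unifIntegrable_maximalFunction_iff.1 hUI ε hε
      exact ⟨δ, hδ, fun M hM => h1 ⟨M, hM⟩⟩
    have hbd : ∀ M ∈ K, ‖M‖ ≤ C := fun M hM => by
      have := hC ⟨M, hM⟩
      rw [HardySpace.eLpNorm_maximalFunction, ← ENNReal.ofReal_coe_nnreal] at this
      exact (ENNReal.ofReal_le_ofReal_iff C.coe_nonneg).1 this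
    refine isRelWeaklyCompact_of_convexHull_tendsto hbd fun M hM => ?_
    obtain ⟨N, hN, N', hlim⟩ := h M hM
    have hsub : ∀ i, {L | ∃ n ≥ i, L = M n} ⊆ K := by
      rintro i _ ⟨n, -, rfl⟩
      exact hM n
    have hNK : ∀ i, N i ∈ convexHull ℝ K := fun i => convexHull_mono (hsub i) (hN i)
    have hNbd : ∀ i, ‖N i‖ ≤ C := fun i => by
      have := convexHull_min (fun L hL => mem_closedBall_zero_iff.2 (hbd L hL))
        (convex_closedBall (0 : HardySpace 𝓕 μ E) C) (hNK i)
      exact mem_closedBall_zero_iff.1 this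
    have hex := fun i : ℕ => HardySpace.exists_convexHull_norm_le hE
      (P := fun k => N k - N') (fun ε hε => by
        obtain ⟨δ, hδ, h1⟩ := hac.convexHull.sub N' ε hε
        refine ⟨δ, hδ, ?_⟩
        rintro _ ⟨k, rfl⟩
        exact h1 _ ⟨N k, hNK k, rfl⟩)
      (C := C + ‖N'‖) (fun k => (norm_sub_le _ _).trans (add_le_add_left (hNbd k) _))
      (fun n => by
        filter_upwards [hlim n, ae_all_iff.2 fun k => HardySpace.process_sub (N k) N']
          with ω h1 h2 f
        have h3 := ((WeakBilin.eval_continuous (topDualPairing ℝ E).flip f).tendsto _).comp h1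
        have h4 := h3.sub_const (f (N'.process n ω))
        rw [show (((topDualPairing ℝ E).flip (toWeakSpace ℝ E (N'.process n ω))) f -
          f (N'.process n ω)) = 0 from sub_self _] at h4
        refine h4.congr fun k => ?_
        rw [h2 k n, map_sub]
        rfl)
      i (ε := 1 / ((i : ℝ) + 1)) (by positivity)
    choose Q hQ1 hQ2 using hex
    refine ⟨fun i => Q i + N', fun i => ?_, N', ?_⟩
    · have h1 : Convex ℝ ((· + N') ⁻¹' convexHull ℝ {L | ∃ n ≥ i, L = M n}) :=
        (convex_convexHull ℝ _).translate_preimage_left N'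
      refine convexHull_min ?_ h1 (hQ1 i)
      rintro _ ⟨k, hk, rfl⟩
      rw [mem_preimage, sub_add_cancel]
      refine convexHull_mono ?_ (hN k)
      rintro L ⟨n, hn, rfl⟩
      exact ⟨n, le_trans hk hn, rfl⟩
    · refine tendsto_of_norm_sub_le (b := fun i : ℕ => 1 / ((i : ℝ) + 1)) (fun i => ?_)
        tendsto_one_div_add_atTop_nhds_zero_nat
      rw [norm_sub_rev, add_sub_cancel_right]
      exact hQ2 i
  tfae_finish
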